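/- Let $\mathcal H$ be a separable complex Hilbert space (of finite or infinite dimension) and $\mathfrak S(\mathcal H)$ the set of states, i.e. positive trace-class operators on $\mathcal H$ with unit trace, with the topology of the trace norm $\|\cdot\|_1$. Let $\mathfrak S_0\subseteq\mathfrak S(\mathcal H)$ be a convex set containing all finite-rank states. Let $f:\mathfrak S_0\to[0,+\infty]$ be lower semicontinuous and locally almost affine (LAA), i.e. $$p f(\rho)+(1-p)f(\sigma)-a_f(p)\le f(p\rho+(1-p)\sigma)\le p f(\rho)+(1-p)f(\sigma)+b_f(p)$$ for all $\rho,\sigma\in\mathfrak S_0$ and $p\in[0,1]$, where $a_f,b_f$ are real functions that vanish as $p\to0^+$ and are non-decreasing on $[0,\frac12]$. Let $\{\rho_n\}$ and $\{\tau_n\}$ be sequences in $\mathfrak S_0$ converging to states $\rho_0$ and $\tau_0$ in $\mathfrak S_0$ such that $c\rho_n\le\tau_n$ for some $c>0$ and all $n\ge0$. Assume that $\mathfrak S_0$ contains every state $\omega$ such that $\omega\le t\,\tau_n$ for some $t>0$ and some $n\ge0$ (this is automatic if $\mathfrak S_0=\mathfrak S(\mathcal H)$), and that $f(\tau_n)<+\infty$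 for all $n\ge0$. Then $f(\rho_n)<+\infty$ for all $n\ge0$, and the following holds. (A) If $f$ is bounded on the set of pure states, i.e. $\sup_{\|\varphi\|=1}f(|\varphi\rangle\langle\varphi|)<+\infty$, then $$\limsup_{n\to+\infty}f(\rho_n)-f(\rho_0)\le\frac1c\Bigl(\limsup_{n\to+\infty}f(\tau_n)-f(\tau_0)\Bigr).$$ In particular, if $\lim_{n\to+\infty}f(\tau_n)=f(\tau_0)<+\infty$, then $\lim_{n\to+\infty}f(\rho_n)=f(\rho_0)<+\infty$. (B) Without assuming $f$ bounded on pure states, suppose that $\lim_{n\to+\infty}f(\tau_n)=f(\tau_0)<+\infty$ and that there is a real function $G$ on $[0,+\infty)$ with $G(0)=0$ and $G(x)\to0$ as $x\to0^+$ such that $$\limsup_{n\to+\infty}f(\rho'_n)-f(\rho'_0)\le G\Bigl(\limsup_{n\to+\infty}f(\tau'_n)-f(\tau'_0)\Bigr)$$ for any sequences of states $\{\rho'_n\}$ and $\{\tau'_n\}$ converging to states $\rho'_0$ and $\tau'_0$ such that $\rho'_n\le2\rho_n$ and $c\rho'_n\le2\tau'_n\le4\tau_n$ for all $n\ge0$ and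 $\sup_n\operatorname{rank}\tau'_n<+\infty$. Then $\lim_{n\to+\infty}f(\rho_n)=f(\rho_0)<+\infty$. -/

import Mathlib

open Filter Topology Set

/-- The trace `Tr A = ∑ᵢ ⟨A eᵢ, eᵢ⟩ ∈ [0, ∞]` of a positive bounded operator `A`, computed in some
orthonormal basis of `H`; by `posTrace_eq_tsum` below every orthonormal basis gives the same value. -/
noncomputable def posTrace {H : Type*} [NormedAddCommGroup H] [InnerProductSpace ℂ H]
    [CompleteSpace H] (A : H →L[ℂ] H) : ENNReal :=
  ∑' i, ENNReal.ofReal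
    (inner ℂ (A ((exists_hilbertBasis ℂ H).choose_spec.choose i))
      ((exists_hilbertBasis ℂ H).choose_spec.choose i)).re

theorem HilbertBasis.tsum_enorm_inner_sq {ι H : Type*} [NormedAddCommGroup H]
    [InnerProductSpace ℂ H] [CompleteSpace H] (b : HilbertBasis ι ℂ H) (x : H) :
    ∑' i, ENNReal.ofReal (‖inner ℂ (b i) x‖ ^ 2) = ENNReal.ofReal (‖x‖ ^ 2) := by
  have h := b.hasSum_inner_mul_inner x x
  have h2 : HasSum (fun i => ‖inner ℂ (b i) x‖ ^ 2) (‖x‖ ^ 2) := by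
    have h3 := Complex.hasSum_re h
    have e1 : (inner ℂ x x).re = ‖x‖ ^ 2 := by
      have := inner_self_eq_norm_sq (𝕜 := ℂ) x
      simpa using this
    rw [e1] at h3
    convert h3 using 2 with i
    rw [← inner_conj_symm x (b i)]
    rw [← Complex.normSq_eq_conj_mul_self, Complex.ofReal_re, Complex.normSq_eq_norm_sq]
  rw [← h2.tsum_eq, ENNReal.ofReal_tsum_of_nonneg (fun i => by positivity) h2.summable]

theorem posTrace_basis_indep {ι κ H : Type*} [NormedAddCommGroup H]
    [InnerProductSpace ℂ H] [CompleteSpace H] (b : HilbertBasis ι ℂ H) (d : HilbertBasis κ ℂ H)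
    {A : H →L[ℂ] H} (hA : 0 ≤ A) :
    ∑' i, ENNReal.ofReal (inner ℂ (A (b i)) (b i)).re
      = ∑' j, ENNReal.ofReal (inner ℂ (A (d j)) (d j)).re := by
  obtain ⟨B, hB, hAB⟩ : ∃ B : H →L[ℂ] H, (∀ x y, inner ℂ (B x) y = inner ℂ x (B y)) ∧
      B * B = A := by
    refine ⟨CFC.sqrt A, ?_, CFC.sqrt_mul_sqrt_self A hA⟩
    have hs : (CFC.sqrt A).IsPositive :=
      (ContinuousLinearMap.nonneg_iff_isPositive _).1 (CFC.sqrt_nonneg A)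
    exact fun x y => hs.isSymmetric x y
  have key : ∀ x, (inner ℂ (A x) x).re = ‖B x‖ ^ 2 := by
    intro x
    rw [← hAB, mul_apply_eq_comp, hB]
    have := inner_self_eq_norm_sq (𝕜 := ℂ) (B x)
    simpa using this
  simp_rw [key]
  calc ∑' i, ENNReal.ofReal (‖B (b i)‖ ^ 2)
      = ∑' i, ∑' j, ENNReal.ofReal (‖inner ℂ (d j) (B (b i))‖ ^ 2) := by
        simp_rw [d.tsum_enorm_inner_sq]
    _ = ∑' j, ∑' i, ENNReal.ofReal (‖inner ℂ (d j) (B (b i))‖ ^ 2) := ENNReal.tsum_comm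
    _ = ∑' j, ∑' i, ENNReal.ofReal (‖inner ℂ (b i) (B (d j))‖ ^ 2) := by
        refine tsum_congr fun j => tsum_congr fun i => ?_
        rw [← hB, norm_inner_symm]
    _ = ∑' j, ENNReal.ofReal (‖B (d j)‖ ^ 2) := by simp_rw [b.tsum_enorm_inner_sq]

/-- The trace of a positive operator does not depend on the orthonormal basis. -/
theorem posTrace_eq_tsum {ι H : Type*} [NormedAddCommGroup H] [InnerProductSpace ℂ H]
    [CompleteSpace H] (b : HilbertBasis ι ℂ H) {A : H →L[ℂ] H} (hA : 0 ≤ A) :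
    posTrace A = ∑' i, ENNReal.ofReal (inner ℂ (A (b i)) (b i)).re :=
  posTrace_basis_indep _ b hA

/-- The trace norm `‖T‖₁ = Tr |T|`, where `|T| = √(T* T)`; it is `∞` exactly when `T` is not of
trace class. -/
noncomputable def traceNorm {H : Type*} [NormedAddCommGroup H] [InnerProductSpace ℂ H]
    [CompleteSpace H] (T : H →L[ℂ] H) : ENNReal :=
  posTrace (CFC.abs T)

/-- The set of quantum states on `H`: positive (trace class) operators of unit trace. The order on
operators is the usual one: `A ≤ B` iff `B - A` is positive. -/
def quantumStates (H : Type*) [NormedAddCommGroup H] [InnerProductSpace ℂ H]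
    [CompleteSpace H] : Set (H →L[ℂ] H) :=
  {ρ | 0 ≤ ρ ∧ posTrace ρ = 1}

/-- `u n → A` in the trace norm. -/
def TraceTendsto {H : Type*} [NormedAddCommGroup H] [InnerProductSpace ℂ H]
    [CompleteSpace H] (u : ℕ → H →L[ℂ] H) (A : H →L[ℂ] H) : Prop :=
  Tendsto (fun n => traceNorm (u n - A)) atTop (𝓝 0)

/-- Lower semicontinuity on `S` with respect to the trace norm. -/
def TraceLowerSemicontinuousOn {H : Type*} [NormedAddCommGroup H] [InnerProductSpace ℂ H]
    [CompleteSpace H] (f : (H →L[ℂ] H) → EReal) (S : Set (H →L[ℂ] H)) : Prop :=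
  ∀ ρ ∈ S, ∀ y : EReal, y < f ρ →
    ∃ δ : ENNReal, 0 < δ ∧ ∀ σ ∈ S, traceNorm (σ - ρ) < δ → y < f σ

/-- The rank of `A` is at most `m`. (The support of a positive operator is the closure of its range,
so the dimension of the support is at most `m` iff the dimension of the range is.) -/
def RankAtMost {H : Type*} [NormedAddCommGroup H] [InnerProductSpace ℂ H]
    (A : H →L[ℂ] H) (m : ℕ) : Prop :=
  LinearMap.rank (A : H →ₗ[ℂ] H) ≤ (m : Cardinal)

/-- Locally almost affine functions on a convex set `S` of states:
`p f(ρ) + (1-p) f(σ) - a(p) ≤ f(p ρ + (1-p) σ) ≤ p f(ρ) + (1-p) f(σ) + b(p)`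
on `S × S × [0,1]`, with `a` and `b` vanishing as `p → 0⁺` and nondecreasing on `[0,1/2]`. -/
def LocallyAlmostAffineOn {H : Type*} [NormedAddCommGroup H] [InnerProductSpace ℂ H]
    [CompleteSpace H] (f : (H →L[ℂ] H) → EReal) (S : Set (H →L[ℂ] H)) : Prop :=
  ∃ a b : ℝ → ℝ,
    Tendsto a (𝓝[>] 0) (𝓝 0) ∧ Tendsto b (𝓝[>] 0) (𝓝 0) ∧
    MonotoneOn a (Icc 0 (1 / 2)) ∧ MonotoneOn b (Icc 0 (1 / 2)) ∧
    ∀ ρ ∈ S, ∀ σ ∈ S, ∀ p ∈ Icc (0 : ℝ) 1,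
      (p : EReal) * f ρ + ((1 - p : ℝ) : EReal) * f σ - (a p : EReal) ≤ f (p • ρ + (1 - p) • σ) ∧
      f (p • ρ + (1 - p) • σ) ≤ (p : EReal) * f ρ + ((1 - p : ℝ) : EReal) * f σ + (b p : EReal)

/-- `limsup_{n → ∞} f(u n) - f(u 0)`, for a sequence `u` whose limit is `u 0` (convention: the limit
of a sequence is stored as its term of index `0`). -/
noncomputable def discontinuityJump {H : Type*} [NormedAddCommGroup H] [InnerProductSpace ℂ H]
    (f : (H →L[ℂ] H) → EReal) (u : ℕ → H →L[ℂ] H) : EReal :=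
  limsup (fun n => f (u n)) atTop - f (u 0)

/-- `lim_{n → ∞} f(u n)` exists and equals `f(u 0) < +∞`. -/
def ConvergesAlong {H : Type*} [NormedAddCommGroup H] [InnerProductSpace ℂ H]
    (f : (H →L[ℂ] H) → EReal) (u : ℕ → H →L[ℂ] H) : Prop :=
  Tendsto (fun n => f (u n)) atTop (𝓝 (f (u 0))) ∧ f (u 0) < ⊤

/-! ### Trace and trace norm of operators -/

section Trace

set_option linter.unusedSectionVars false

variable {H : Type*} [NormedAddCommGroup H] [InnerProductSpace ℂ H] [CompleteSpace H]

/-! Let F(X) = Tr X · f(X / Tr X) be the homogeneous extension of f (`homExt`). Local almost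
affinity says that F is nearly additive (`homExt_add`): if Tr X ≤ q Tr(X+Y) with q ≤ 1/2, then
|F(X+Y) − F(X) − F(Y)| ≤ Tr(X+Y) w(q). So a summand of small relative trace splits off at small
cost, and a sum of small total trace splits at small cost whatever the proportions
(`homExt_add_half`).

Truncating ρₙ and τₙ − cρₙ separately (`exists_isSplitting`) gives ρₙ = Aₙ + Rₙ and τₙ = Bₙ + Sₙ,
where Aₙ and Bₙ have bounded rank and converge, Rₙ and Sₙ have trace below η, cAₙ ≤ Bₙ, and Kₙ = Sₙ
− cRₙ ≥ 0. Up to errors vanishing with η, F(τₙ) = F(Bₙ) + cF(Rₙ) + F(Kₙ) and F(ρₙ) = F(Aₙ) + F(Rₙ).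
Since Bₙ and Kₙ converge and F is lower semicontinuous, F(Bₙ) and F(Kₙ) cannot jump down; hence an
upward jump of cF(Rₙ) is paid for by one of F(τₙ). What is left is to show that F(Aₙ) does not jump
up (`IsSplitting.eventually_mul_sub_le`).

In (A), boundedness on pure states makes F bounded by a multiple of the trace at each fixed rank,
and this gives upper semicontinuity along sequences of bounded rank (`eventually_homExt_le`). In
(B), the normalized Aₙ and Bₙ are admissible test sequences; convergence of f(τₙ) makes the jump
along the normalized Bₙ small, and G transfers this to the Aₙ (`eventually_homExt_left_le_of_jump`).
-/

theorem re_inner_nonneg_of_nonneg {A : H →L[ℂ] H} (hA : 0 ≤ A) (x : H) :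
    0 ≤ (inner ℂ (A x) x).re :=
  ((ContinuousLinearMap.nonneg_iff_isPositive _).1 hA).re_inner_nonneg_left x

theorem re_inner_mono {A B : H →L[ℂ] H} (hAB : A ≤ B) (x : H) :
    (inner ℂ (A x) x).re ≤ (inner ℂ (B x) x).re := by
  have h := re_inner_nonneg_of_nonneg (sub_nonneg.2 hAB) x
  rw [sub_apply, inner_sub_left, Complex.sub_re] at h
  linarith

theorem posTrace_mono {A B : H →L[ℂ] H} (hAB : A ≤ B) : posTrace A ≤ posTrace B :=
  ENNReal.tsum_le_tsum fun _ => ENNReal.ofReal_le_ofReal (re_inner_mono hAB _)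

theorem posTrace_zero : posTrace (0 : H →L[ℂ] H) = 0 := by
  simp [posTrace]

theorem posTrace_add {A B : H →L[ℂ] H} (hA : 0 ≤ A) (hB : 0 ≤ B) :
    posTrace (A + B) = posTrace A + posTrace B := by
  unfold posTrace
  rw [← ENNReal.tsum_add]
  refine tsum_congr fun i => ?_
  rw [add_apply, inner_add_left, Complex.add_re,
    ENNReal.ofReal_add (re_inner_nonneg_of_nonneg hA _) (re_inner_nonneg_of_nonneg hB _)]

theorem posTrace_smul {r : ℝ} (hr : 0 ≤ r) (A : H →L[ℂ] H) :
    posTrace (r • A) = ENNReal.ofReal r * posTrace A := by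
  unfold posTrace
  rw [← ENNReal.tsum_mul_left]
  refine tsum_congr fun i => ?_
  rw [smul_apply, RCLike.real_smul_eq_coe_smul (K := ℂ), inner_smul_left,
    ← ENNReal.ofReal_mul hr]
  simp

/-- Extend the orthonormal set to a Hilbert basis and use basis independence of the trace. -/
theorem tsum_re_inner_le_posTrace {A : H →L[ℂ] H} (hA : 0 ≤ A) {s : Set H}
    (hs : Orthonormal ℂ ((↑) : s → H)) :
    ∑' x : s, ENNReal.ofReal (inner ℂ (A x) (x : H)).re ≤ posTrace A := by
  obtain ⟨w, b, hsw, hb⟩ := hs.exists_hilbertBasis_extension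
  rw [posTrace_eq_tsum b hA, hb]
  exact ENNReal.tsum_mono_subtype (fun x : H => ENNReal.ofReal (inner ℂ (A x) x).re) hsw

theorem sum_re_inner_le_posTrace {A : H →L[ℂ] H} (hA : 0 ≤ A) {ι : Type*} [Fintype ι] {v : ι → H}
    (hv : Orthonormal ℂ v) :
    ∑ i, ENNReal.ofReal (inner ℂ (A (v i)) (v i)).re ≤ posTrace A := by
  refine le_trans (le_of_eq ?_) (tsum_re_inner_le_posTrace hA hv.toSubtypeRange)
  rw [← tsum_fintype (L := .unconditional _)]
  exact (Equiv.ofInjective v hv.linearIndependent.injective).tsum_eq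
    (fun x : range v => ENNReal.ofReal (inner ℂ (A x) (x : H)).re)

theorem re_inner_le_posTrace {A : H →L[ℂ] H} (hA : 0 ≤ A) (htr : posTrace A ≠ ⊤) (x : H) :
    (inner ℂ (A x) x).re ≤ (posTrace A).toReal * ‖x‖ ^ 2 := by
  have key : ∀ y : H, ‖y‖ = 1 → (inner ℂ (A y) y).re ≤ (posTrace A).toReal := by
    intro y hy
    have hv : Orthonormal ℂ (fun _ : Unit => y) :=
      ⟨fun _ => hy, fun i j hij => (hij (Subsingleton.elim i j)).elim⟩
    have h := sum_re_inner_le_posTrace hA hv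
    rw [Fintype.sum_unique] at h
    exact (ENNReal.ofReal_le_iff_le_toReal htr).1 h
  rcases eq_or_ne x 0 with rfl | hx
  · simp
  have hn : ‖x‖ ≠ 0 := norm_ne_zero_iff.2 hx
  have h := key ((‖x‖⁻¹ : ℂ) • x) (by rw [norm_smul]; simp [hn])
  rw [map_smul, inner_smul_left, inner_smul_right] at h
  have e : ((starRingEnd ℂ) (‖x‖⁻¹ : ℂ) * ((‖x‖⁻¹ : ℂ) * inner ℂ (A x) x)).re
      = ‖x‖⁻¹ * (‖x‖⁻¹ * (inner ℂ (A x) x).re) := by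
    rw [← Complex.ofReal_inv, Complex.conj_ofReal, Complex.re_ofReal_mul, Complex.re_ofReal_mul]
  rw [e] at h
  have hp : 0 < ‖x‖ := norm_pos_iff.2 hx
  calc (inner ℂ (A x) x).re = ‖x‖⁻¹ * (‖x‖⁻¹ * (inner ℂ (A x) x).re) * ‖x‖ ^ 2 := by
        field_simp
    _ ≤ _ := by gcongr

theorem isSelfAdjoint_of_sub {A B : H →L[ℂ] H} (hA : 0 ≤ A) (hB : 0 ≤ B) :
    IsSelfAdjoint (A - B) :=
  (IsSelfAdjoint.of_nonneg hA).sub (IsSelfAdjoint.of_nonneg hB)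

theorem le_of_re_inner_le {A B : H →L[ℂ] H} (hA : IsSelfAdjoint A) (hB : IsSelfAdjoint B)
    (h : ∀ x, (inner ℂ (A x) x).re ≤ (inner ℂ (B x) x).re) : A ≤ B := by
  rw [← sub_nonneg, ContinuousLinearMap.nonneg_iff_isPositive, ContinuousLinearMap.isPositive_def']
  refine ⟨hB.sub hA, fun x => ?_⟩
  rw [ContinuousLinearMap.reApplyInnerSelf_apply, sub_apply, inner_sub_left, map_sub]
  exact sub_nonneg.2 (h x)

theorem norm_le_posTrace {A : H →L[ℂ] H} (hA : 0 ≤ A) (htr : posTrace A ≠ ⊤) :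
    ‖A‖ ≤ (posTrace A).toReal := by
  rw [CStarAlgebra.norm_le_iff_le_algebraMap A ENNReal.toReal_nonneg hA]
  refine le_of_re_inner_le (IsSelfAdjoint.of_nonneg hA) (.algebraMap _ (.all _)) fun x => ?_
  refine (re_inner_le_posTrace hA htr x).trans (le_of_eq ?_)
  rw [Algebra.algebraMap_eq_smul_one, smul_apply, one_apply_eq_self,
    RCLike.real_smul_eq_coe_smul (K := ℂ), inner_smul_left]
  have := inner_self_eq_norm_sq (𝕜 := ℂ) x
  simp at this ⊢
  rw [this]
  simp

theorem eq_zero_of_posTrace_eq_zero {A : H →L[ℂ] H} (hA : 0 ≤ A) (h : posTrace A = 0) : A = 0 := by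
  have := norm_le_posTrace hA (by simp [h])
  rw [h] at this
  simpa using this

/-- Both sides are the double sum of |⟨eⱼ, X eᵢ⟩|², taken in the two orders. -/
theorem posTrace_star_mul_self_comm (X : H →L[ℂ] H) :
    posTrace (star X * X) = posTrace (X * star X) := by
  obtain ⟨w, b, -⟩ := exists_hilbertBasis ℂ H
  rw [posTrace_eq_tsum b (star_mul_self_nonneg X), posTrace_eq_tsum b (mul_star_self_nonneg X)]
  have k1 : ∀ (Y : H →L[ℂ] H) x, (inner ℂ ((star Y * Y) x) x).re = ‖Y x‖ ^ 2 := by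
    intro Y x
    rw [mul_apply_eq_comp, ContinuousLinearMap.star_eq_adjoint,
      ContinuousLinearMap.adjoint_inner_left]
    simpa using inner_self_eq_norm_sq (𝕜 := ℂ) (Y x)
  have k2 : ∀ x, (inner ℂ ((X * star X) x) x).re = ‖(star X) x‖ ^ 2 := by
    intro x
    simpa using k1 (star X) x
  simp_rw [k1, k2]
  calc ∑' i, ENNReal.ofReal (‖X (b i)‖ ^ 2)
      = ∑' i, ∑' j, ENNReal.ofReal (‖inner ℂ (b j) (X (b i))‖ ^ 2) := by
        simp_rw [b.tsum_enorm_inner_sq]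
    _ = ∑' j, ∑' i, ENNReal.ofReal (‖inner ℂ (b j) (X (b i))‖ ^ 2) := ENNReal.tsum_comm
    _ = ∑' j, ∑' i, ENNReal.ofReal (‖inner ℂ (b i) ((star X) (b j))‖ ^ 2) := by
        refine tsum_congr fun j => tsum_congr fun i => ?_
        rw [ContinuousLinearMap.star_eq_adjoint, ContinuousLinearMap.adjoint_inner_right,
          norm_inner_symm]
    _ = ∑' j, ENNReal.ofReal (‖(star X) (b j)‖ ^ 2) := by simp_rw [b.tsum_enorm_inner_sq]

theorem traceNorm_of_nonneg {A : H →L[ℂ] H} (hA : 0 ≤ A) : traceNorm A = posTrace A := by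
  rw [traceNorm, CFC.abs_of_nonneg A hA]

theorem traceNorm_neg (A : H →L[ℂ] H) : traceNorm (-A) = traceNorm A := by
  rw [traceNorm, CFC.abs_neg, traceNorm]

theorem self_le_abs {D : H →L[ℂ] H} (hD : IsSelfAdjoint D) : D ≤ CFC.abs D := by
  rw [← sub_nonneg, CFC.abs_sub_self D hD]
  exact smul_nonneg (by norm_num) (CFC.negPart_nonneg D)

theorem neg_abs_le_self {D : H →L[ℂ] H} (hD : IsSelfAdjoint D) : -CFC.abs D ≤ D := by
  rw [← sub_nonneg, sub_neg_eq_add, add_comm, CFC.abs_add_self D hD]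
  exact smul_nonneg (by norm_num) (CFC.posPart_nonneg D)

/-- Compressing D to complementary spectral subspaces gives D⁺ and −D⁻, so each part is dominated by
the matching compression of E, and the traces of the two compressions add up to Tr E. The triangle
inequality for the trace norm follows from this. -/
theorem traceNorm_le_posTrace {D E : H →L[ℂ] H} (hD : IsSelfAdjoint D) (h1 : -E ≤ D)
    (h2 : D ≤ E) : traceNorm D ≤ posTrace E := by
  have hE : 0 ≤ E := by
    have h : 0 ≤ (2 : ℝ) • E := by
      rw [two_smul]
      have := sub_nonneg.2 (h1.trans h2)
      rwa [sub_neg_eq_add] at this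
    simpa using smul_nonneg (by norm_num : (0 : ℝ) ≤ 2⁻¹) h
  have hplus := CFC.posPart_nonneg D
  have hminus := CFC.negPart_nonneg D
  -- The kernel of D⁺ contains the range of D⁻, so its projection Q kills D⁺ and fixes D⁻.
  set V : Submodule ℂ H := (D⁺).ker with hV
  have : CompleteSpace V := (ContinuousLinearMap.isClosed_ker (D⁺)).completeSpace_coe
  set Q : H →L[ℂ] H := V.starProjection with hQ
  have hQs : star Q = Q := isSelfAdjoint_starProjection V
  have hQQ : Q * Q = Q := V.isIdempotentElem_starProjection
  have hpQ : D⁺ * Q = 0 := by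
    ext x
    exact V.starProjection_apply_mem x
  have hQp : Q * D⁺ = 0 := by
    have := congrArg star hpQ
    rwa [star_mul, hQs, (IsSelfAdjoint.of_nonneg hplus).star_eq, star_zero] at this
  have hQm : Q * D⁻ = D⁻ := by
    ext x
    refine Submodule.starProjection_eq_self_iff.2 ?_
    exact congrArg (fun T : H →L[ℂ] H => T x) (CFC.posPart_mul_negPart D)
  have hmQ : D⁻ * Q = D⁻ := by
    have := congrArg star hQm
    rwa [star_mul, hQs, (IsSelfAdjoint.of_nonneg hminus).star_eq] at this
  have hDpm := CFC.posPart_sub_negPart D hD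
  have hPs : star (1 - Q) = 1 - Q := by rw [star_sub, star_one, hQs]
  have e1 : (1 - Q) * D * (1 - Q) = D⁺ := by
    conv_lhs => rw [← hDpm]
    simp only [mul_sub, sub_mul, one_mul, mul_one, hpQ, hQp, hQm, hmQ, zero_mul]
    abel
  have e2 : Q * D * Q = -D⁻ := by
    conv_lhs => rw [← hDpm]
    simp only [mul_sub, sub_mul, hQp, hQm, hmQ, zero_mul]
    abel
  have i1 : D⁺ ≤ (1 - Q) * E * (1 - Q) := by
    have := star_left_conjugate_nonneg (sub_nonneg.2 h2) (1 - Q)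
    rw [hPs, mul_sub (1 - Q) E D, sub_mul _ _ (1 - Q), e1] at this
    exact sub_nonneg.1 this
  have i2 : D⁻ ≤ Q * E * Q := by
    have := star_left_conjugate_nonneg (sub_nonneg.2 h1) Q
    rw [hQs, mul_sub, sub_mul, e2, mul_neg, neg_mul] at this
    have h3 : -D⁻ - -(Q * E * Q) = Q * E * Q - D⁻ := by abel
    rw [h3] at this
    exact sub_nonneg.1 this
  set B := CFC.sqrt E with hB
  have hBB : B * B = E := CFC.sqrt_mul_sqrt_self E hE
  have hBs : star B = B := (IsSelfAdjoint.of_nonneg (CFC.sqrt_nonneg E)).star_eq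
  -- Cyclicity applied to √E·P moves the projections inside, where they sum to 1.
  have comm : ∀ P : H →L[ℂ] H, star P = P → P * P = P →
      posTrace (P * E * P) = posTrace (B * P * B) ∧ 0 ≤ B * P * B := by
    intro P hPs hPP
    have h1 : star (B * P) * (B * P) = P * E * P := by
      rw [star_mul, hPs, hBs, ← hBB]; simp only [mul_assoc]
    have h2 : (B * P) * star (B * P) = B * P * B := by
      rw [star_mul, hPs, hBs]
      calc B * P * (P * B) = B * (P * P) * B := by simp only [mul_assoc]
        _ = _ := by rw [hPP]
    exact ⟨by rw [← h1, posTrace_star_mul_self_comm, h2], h2 ▸ mul_star_self_nonneg _⟩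
  have hPP : (1 - Q) * (1 - Q) = 1 - Q := by
    simp only [mul_sub, sub_mul, one_mul, mul_one, hQQ]; abel
  obtain ⟨c1, p1⟩ := comm (1 - Q) hPs hPP
  obtain ⟨c2, p2⟩ := comm Q hQs hQQ
  calc traceNorm D = posTrace (D⁺ + D⁻) := by rw [CFC.posPart_add_negPart D hD, traceNorm]
    _ = posTrace D⁺ + posTrace D⁻ := posTrace_add hplus hminus
    _ ≤ posTrace ((1 - Q) * E * (1 - Q)) + posTrace (Q * E * Q) :=
        add_le_add (posTrace_mono i1) (posTrace_mono i2)
    _ = posTrace (B * (1 - Q) * B) + posTrace (B * Q * B) := by rw [c1, c2]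
    _ = posTrace (B * (1 - Q) * B + B * Q * B) := (posTrace_add p1 p2).symm
    _ = posTrace E := by
        congr 1
        simp only [mul_sub, sub_mul, mul_one, hBB]
        abel

theorem traceNorm_add_le {A B : H →L[ℂ] H} (hA : IsSelfAdjoint A) (hB : IsSelfAdjoint B) :
    traceNorm (A + B) ≤ traceNorm A + traceNorm B := by
  refine (traceNorm_le_posTrace (hA.add hB) (E := CFC.abs A + CFC.abs B) ?_
    (add_le_add (self_le_abs hA) (self_le_abs hB))).trans (le_of_eq ?_)
  · rw [neg_add]
    exact add_le_add (neg_abs_le_self hA) (neg_abs_le_self hB)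
  · exact posTrace_add (CFC.abs_nonneg A) (CFC.abs_nonneg B)

theorem traceNorm_smul (r : ℝ) (A : H →L[ℂ] H) :
    traceNorm (r • A) = ENNReal.ofReal |r| * traceNorm A := by
  rw [traceNorm, CFC.abs_smul, posTrace_smul (norm_nonneg r), Real.norm_eq_abs, traceNorm]

theorem norm_le_traceNorm {D : H →L[ℂ] H} (h : traceNorm D ≠ ⊤) :
    ‖D‖ ≤ (traceNorm D).toReal := by
  rw [← CFC.norm_abs]
  exact norm_le_posTrace (CFC.abs_nonneg D) h

theorem posTrace_le_add_traceNorm_sub {A B : H →L[ℂ] H} (hA : 0 ≤ A) (hB : 0 ≤ B) :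
    posTrace A ≤ posTrace B + traceNorm (A - B) := by
  rw [traceNorm, ← posTrace_add hB (CFC.abs_nonneg _)]
  refine posTrace_mono ?_
  have := self_le_abs (isSelfAdjoint_of_sub hA hB)
  rwa [sub_le_iff_le_add'] at this

end Trace

/-! ### Operators of finite rank -/

section FiniteRank

set_option linter.unusedSectionVars false

variable {H : Type*} [NormedAddCommGroup H] [InnerProductSpace ℂ H] [CompleteSpace H]

theorem posTrace_rankOne (v : H) :
    posTrace (InnerProductSpace.rankOne ℂ v v) = ENNReal.ofReal (‖v‖ ^ 2) := by
  obtain ⟨w, b, -⟩ := exists_hilbertBasis ℂ H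
  rw [posTrace_eq_tsum b ((ContinuousLinearMap.nonneg_iff_isPositive _).2
    (InnerProductSpace.isPositive_rankOne_self v)), ← b.tsum_enorm_inner_sq]
  refine tsum_congr fun i => congrArg _ ?_
  rw [InnerProductSpace.rankOne_apply, inner_smul_left, ← inner_conj_symm v (b i),
    Complex.conj_conj, Complex.mul_conj, Complex.ofReal_re, Complex.normSq_eq_norm_sq]

theorem rankOne_self_nonneg (v : H) : 0 ≤ InnerProductSpace.rankOne ℂ v v :=
  (ContinuousLinearMap.nonneg_iff_isPositive _).2 (InnerProductSpace.isPositive_rankOne_self v)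

theorem posTrace_sum {ι : Type*} (s : Finset ι) {A : ι → H →L[ℂ] H} (hA : ∀ i, 0 ≤ A i) :
    posTrace (∑ i ∈ s, A i) = ∑ i ∈ s, posTrace (A i) := by
  classical
  induction s using Finset.induction_on with
  | empty => simp [posTrace_zero]
  | insert i s hi ih =>
    rw [Finset.sum_insert hi, Finset.sum_insert hi,
      posTrace_add (hA i) (Finset.sum_nonneg fun j _ => hA j), ih]

theorem RankAtMost.finiteDimensional {A : H →L[ℂ] H} {m : ℕ} (h : RankAtMost A m) :
    FiniteDimensional ℂ (A : H →ₗ[ℂ] H).range ∧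
      Module.finrank ℂ (A : H →ₗ[ℂ] H).range ≤ m :=
  ⟨Module.rank_lt_aleph0_iff.1 (h.trans_lt (Cardinal.natCast_lt_aleph0)),
    Module.finrank_le_of_rank_le h⟩

theorem RankAtMost.add {A B : H →L[ℂ] H} {m n : ℕ} (hA : RankAtMost A m) (hB : RankAtMost B n) :
    RankAtMost (A + B) (m + n) := by
  unfold RankAtMost
  push_cast
  exact (LinearMap.rank_add_le _ _).trans (add_le_add hA hB)

theorem RankAtMost.smul {A : H →L[ℂ] H} {m : ℕ} (hA : RankAtMost A m) (r : ℝ) :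
    RankAtMost (r • A) m := by
  refine le_trans (Submodule.rank_mono ?_) hA
  rintro _ ⟨x, rfl⟩
  refine ⟨(r : ℂ) • x, ?_⟩
  simp

theorem RankAtMost.mono {A : H →L[ℂ] H} {m n : ℕ} (hA : RankAtMost A m) (h : m ≤ n) :
    RankAtMost A n :=
  le_trans hA (by exact_mod_cast h)

theorem RankAtMost.sub {A B : H →L[ℂ] H} {m n : ℕ} (hA : RankAtMost A m) (hB : RankAtMost B n) :
    RankAtMost (A - B) (m + n) := by
  have := hA.add (hB.smul (-1))
  rwa [neg_one_smul, ← sub_eq_add_neg] at this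

theorem rankAtMost_rankOne (v w : H) : RankAtMost (InnerProductSpace.rankOne ℂ v w) 1 := by
  refine le_trans (Submodule.rank_mono (t := Submodule.span ℂ {v}) ?_) ?_
  · rintro _ ⟨x, rfl⟩
    exact Submodule.smul_mem _ _ (Submodule.mem_span_singleton_self v)
  · simpa using rank_span_le (R := ℂ) ({v} : Set H)

theorem norm_abs_apply (D : H →L[ℂ] H) (x : H) : ‖CFC.abs D x‖ = ‖D x‖ := by
  have h : ∀ T : H →L[ℂ] H, (inner ℂ ((star T * T) x) x).re = ‖T x‖ ^ 2 := by
    intro T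
    rw [mul_apply_eq_comp, ContinuousLinearMap.star_eq_adjoint,
      ContinuousLinearMap.adjoint_inner_left]
    simpa using inner_self_eq_norm_sq (𝕜 := ℂ) (T x)
  have h1 := h (CFC.abs D)
  rw [(IsSelfAdjoint.of_nonneg (CFC.abs_nonneg D)).star_eq, CFC.abs_mul_abs, h] at h1
  exact ((sq_eq_sq₀ (norm_nonneg _) (norm_nonneg _)).1 h1).symm

/-- ‖|D|x‖ = ‖Dx‖ gives |D| and D the same kernel, hence isomorphic ranges. -/
theorem RankAtMost.abs {D : H →L[ℂ] H} {m : ℕ} (hD : RankAtMost D m) :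
    RankAtMost (CFC.abs D) m := by
  refine le_trans (le_of_eq ?_) hD
  have hk : ((CFC.abs D : H →L[ℂ] H) : H →ₗ[ℂ] H).ker = (D : H →ₗ[ℂ] H).ker := by
    ext x
    rw [LinearMap.mem_ker, LinearMap.mem_ker, ContinuousLinearMap.coe_coe,
      ContinuousLinearMap.coe_coe, ← norm_eq_zero, norm_abs_apply, norm_eq_zero]
  exact ((LinearMap.quotKerEquivRange _).symm.trans ((Submodule.quotEquivOfEq _ _ hk).trans
    (LinearMap.quotKerEquivRange _))).rank_eq

theorem apply_eq_zero_of_mem_orthogonal_range {A : H →L[ℂ] H} (hA : IsSelfAdjoint A) {x : H}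
    (hx : x ∈ ((A : H →ₗ[ℂ] H).range)ᗮ) : A x = 0 := by
  rw [← inner_self_eq_zero (𝕜 := ℂ)]
  have h1 := (Submodule.mem_orthogonal _ x).1 hx (A (A x)) ⟨A x, rfl⟩
  rw [← ContinuousLinearMap.adjoint_inner_right, ← ContinuousLinearMap.star_eq_adjoint,
    hA.star_eq] at h1
  exact h1

/-- With B = √A and P the projection onto the range of A, A = BPB; expanding P in an orthonormal
basis (eᵢ) of the range gives the vectors Beᵢ, with no need to diagonalize A. -/
theorem exists_eq_sum_rankOne {A : H →L[ℂ] H} (hA : 0 ≤ A) {m : ℕ} (hm : RankAtMost A m) :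
    ∃ n ≤ m, ∃ v : Fin n → H, A = ∑ i, InnerProductSpace.rankOne ℂ (v i) (v i) := by
  obtain ⟨hfd, hr⟩ := hm.finiteDimensional
  set V := (A : H →ₗ[ℂ] H).range
  set e := stdOrthonormalBasis ℂ V
  set B := CFC.sqrt A
  have hBs : IsSelfAdjoint B := IsSelfAdjoint.of_nonneg (CFC.sqrt_nonneg A)
  have hBB : B * B = A := CFC.sqrt_mul_sqrt_self A hA
  refine ⟨_, hr, fun i => B (e i), ?_⟩
  have hBx : ∀ x ∈ Vᗮ, B x = 0 := by
    intro x hx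
    have h := apply_eq_zero_of_mem_orthogonal_range (IsSelfAdjoint.of_nonneg hA) hx
    rw [← inner_self_eq_zero (𝕜 := ℂ), ← ContinuousLinearMap.adjoint_inner_right,
      ← ContinuousLinearMap.star_eq_adjoint, hBs.star_eq, ← mul_apply_eq_comp, hBB, h,
      inner_zero_right]
  have hBP : B * V.starProjection = B := by
    ext x
    rw [mul_apply_eq_comp, ← sub_eq_zero, ← map_sub, ← neg_sub, map_neg,
      hBx _ (V.sub_starProjection_mem_orthogonal x), neg_zero]
  calc A = B * V.starProjection * B := by rw [hBP, hBB]
    _ = _ := by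
      rw [e.starProjection_eq_sum_rankOne, Finset.mul_sum, Finset.sum_mul]
      refine Finset.sum_congr rfl fun i _ => ?_
      ext x
      simp only [mul_apply_eq_comp, InnerProductSpace.rankOne_apply, map_smul]
      rw [← ContinuousLinearMap.adjoint_inner_left, ← ContinuousLinearMap.star_eq_adjoint,
        hBs.star_eq]

theorem algebraMap_apply_eq_smul (r : ℝ) (x : H) :
    algebraMap ℝ (H →L[ℂ] H) r x = (r : ℂ) • x := by
  rw [Algebra.algebraMap_eq_smul_one, smul_apply, one_apply_eq_self,
    RCLike.real_smul_eq_coe_smul (K := ℂ)]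
  rfl

theorem re_inner_algebraMap (r : ℝ) (x : H) :
    (inner ℂ (algebraMap ℝ (H →L[ℂ] H) r x) x).re = r * ‖x‖ ^ 2 := by
  rw [algebraMap_apply_eq_smul, inner_smul_left, Complex.conj_ofReal, Complex.re_ofReal_mul]
  congr 1
  simpa using inner_self_eq_norm_sq (𝕜 := ℂ) x

/-- A is at most ‖A‖ times the projection onto its range. At bounded rank this upgrades
operator-norm convergence to trace-norm convergence. -/
theorem posTrace_le_rank_mul_norm {A : H →L[ℂ] H} (hA : 0 ≤ A) {m : ℕ} (hm : RankAtMost A m) :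
    posTrace A ≤ m * ENNReal.ofReal ‖A‖ := by
  obtain ⟨hfd, hr⟩ := hm.finiteDimensional
  set V := (A : H →ₗ[ℂ] H).range
  set e := stdOrthonormalBasis ℂ V
  have hAs := IsSelfAdjoint.of_nonneg hA
  have hle : A ≤ ‖A‖ • V.starProjection := by
    refine le_of_re_inner_le hAs (.smul (.all _) (isSelfAdjoint_starProjection V)) fun x => ?_
    have h1 : A x = A (V.starProjection x) := by
      rw [← sub_eq_zero, ← map_sub]
      exact apply_eq_zero_of_mem_orthogonal_range hAs (V.sub_starProjection_mem_orthogonal x)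
    have h2 : inner ℂ (A x) x = inner ℂ (A (V.starProjection x)) (V.starProjection x) := by
      rw [← h1, ← Submodule.inner_starProjection_left_eq_right,
        Submodule.starProjection_eq_self_iff.2 (show A x ∈ V from ⟨x, rfl⟩)]
    have h3 := re_inner_mono hAs.le_algebraMap_norm_self (V.starProjection x)
    rw [re_inner_algebraMap] at h3
    rw [h2]
    refine h3.trans (le_of_eq ?_)
    rw [smul_apply, RCLike.real_smul_eq_coe_smul (K := ℂ), inner_smul_left]
    have h4 := V.re_inner_starProjection_eq_normSq x
    simp at h4 ⊢
    exact Or.inl h4.symm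
  refine (posTrace_mono hle).trans ?_
  rw [posTrace_smul (norm_nonneg _), mul_comm]
  gcongr
  rw [e.starProjection_eq_sum_rankOne, posTrace_sum _ fun i => rankOne_self_nonneg _]
  have : ∀ i, posTrace (InnerProductSpace.rankOne ℂ (e i : H) (e i : H)) = 1 := by
    intro i
    rw [posTrace_rankOne]
    have : ‖(e i : H)‖ = 1 := e.orthonormal.1 i
    simp [this]
  simp only [this, Finset.sum_const, Finset.card_univ, Fintype.card_fin, nsmul_eq_mul, mul_one]
  exact_mod_cast hr

theorem rankAtMost_of_forall_orthonormal {A : H →L[ℂ] H} {m : ℕ}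
    (h : ∀ e : Fin (m + 1) → H, Orthonormal ℂ e → ¬ ∀ i, ∃ y, A y = e i) : RankAtMost A m := by
  by_contra hlt
  have h1 : ((m + 1 : ℕ) : Cardinal) ≤ Module.rank ℂ (A : H →ₗ[ℂ] H).range := by
    have h2 : (m : Cardinal) < Module.rank ℂ (A : H →ₗ[ℂ] H).range := not_le.1 hlt
    have h3 := Order.succ_le_of_lt h2
    simpa using h3
  obtain ⟨v, hv⟩ := natCast_le_rank_iff.1 h1
  have ho := InnerProductSpace.gramSchmidtNormed_orthonormal (𝕜 := ℂ) hv
  exact h _ (ho.comp_linearIsometry (Submodule.subtypeₗᵢ _)) fun i =>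
    (InnerProductSpace.gramSchmidtNormed ℂ v i).2

end FiniteRank

/-! ### Truncation to bounded rank, continuous in trace norm -/

section Truncation

set_option linter.unusedSectionVars false

variable {H : Type*} [NormedAddCommGroup H] [InnerProductSpace ℂ H] [CompleteSpace H]

theorem TraceTendsto.add {u v : ℕ → H →L[ℂ] H} {A B : H →L[ℂ] H} (hu : TraceTendsto u A)
    (hv : TraceTendsto v B) (hus : ∀ n, IsSelfAdjoint (u n)) (hvs : ∀ n, IsSelfAdjoint (v n))
    (hA : IsSelfAdjoint A) (hB : IsSelfAdjoint B) :
    TraceTendsto (fun n => u n + v n) (A + B) := by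
  have h := Tendsto.add hu hv
  rw [add_zero] at h
  refine tendsto_of_tendsto_of_tendsto_of_le_of_le tendsto_const_nhds h (fun _ => zero_le) ?_
  intro n
  have e : u n + v n - (A + B) = (u n - A) + (v n - B) := by abel
  simp only [e]
  exact traceNorm_add_le ((hus n).sub hA) ((hvs n).sub hB)

theorem TraceTendsto.const_smul {u : ℕ → H →L[ℂ] H} {A : H →L[ℂ] H} (hu : TraceTendsto u A)
    (r : ℝ) : TraceTendsto (fun n => r • u n) (r • A) := by
  have h := ENNReal.Tendsto.const_mul (a := ENNReal.ofReal |r|) hu (Or.inr ENNReal.ofReal_ne_top)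
  rw [mul_zero] at h
  refine h.congr fun n => ?_
  rw [← smul_sub, traceNorm_smul]

theorem TraceTendsto.smul {u : ℕ → H →L[ℂ] H} {A : H →L[ℂ] H} (hu : TraceTendsto u A)
    (hus : ∀ n, IsSelfAdjoint (u n)) (hA : IsSelfAdjoint A) (hAf : traceNorm A ≠ ⊤)
    {r : ℕ → ℝ} {r₀ : ℝ} (hr : Tendsto r atTop (𝓝 r₀)) :
    TraceTendsto (fun n => r n • u n) (r₀ • A) := by
  have h1 : Tendsto (fun n => ENNReal.ofReal |r n| * traceNorm (u n - A)) atTop (𝓝 0) := by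
    have := ENNReal.Tendsto.mul (ENNReal.tendsto_ofReal hr.abs) (Or.inr ENNReal.zero_ne_top) hu
      (Or.inr ENNReal.ofReal_ne_top)
    rwa [mul_zero] at this
  have h2 : Tendsto (fun n => ENNReal.ofReal |r n - r₀| * traceNorm A) atTop (𝓝 0) := by
    have h3 : Tendsto (fun n => |r n - r₀|) atTop (𝓝 0) := by
      simpa using (hr.sub_const r₀).abs
    have := ENNReal.Tendsto.mul_const (b := traceNorm A) (ENNReal.tendsto_ofReal h3) (Or.inr hAf)
    rwa [ENNReal.ofReal_zero, zero_mul] at this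
  have h := h1.add h2
  rw [add_zero] at h
  refine tendsto_of_tendsto_of_tendsto_of_le_of_le tendsto_const_nhds h (fun _ => zero_le) ?_
  intro n
  have e : r n • u n - r₀ • A = r n • (u n - A) + (r n - r₀) • A := by
    rw [smul_sub, sub_smul]; abel
  simp only [e]
  rw [← traceNorm_smul, ← traceNorm_smul]
  exact traceNorm_add_le (.smul (.all _) ((hus n).sub hA)) (.smul (.all _) hA)

theorem TraceTendsto.tendsto_posTrace {u : ℕ → H →L[ℂ] H} {A : H →L[ℂ] H} (hu : TraceTendsto u A)
    (hpos : ∀ n, 0 ≤ u n) (hA : 0 ≤ A) :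
    Tendsto (fun n => posTrace (u n)) atTop (𝓝 (posTrace A)) := by
  have h1 : Tendsto (fun n => posTrace A + traceNorm (u n - A)) atTop (𝓝 (posTrace A)) := by
    have := Tendsto.const_add (posTrace A) hu
    rwa [add_zero] at this
  have h2 : Tendsto (fun n => posTrace A - traceNorm (u n - A)) atTop (𝓝 (posTrace A)) := by
    have := ENNReal.Tendsto.sub (tendsto_const_nhds (x := posTrace A)) hu
      (Or.inr ENNReal.zero_ne_top)
    rwa [tsub_zero] at this
  refine tendsto_of_tendsto_of_tendsto_of_le_of_le h2 h1 (fun n => ?_) fun n =>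
    posTrace_le_add_traceNorm_sub (hpos n) hA
  rw [tsub_le_iff_right, ← traceNorm_neg, neg_sub]
  exact posTrace_le_add_traceNorm_sub hA (hpos n)

theorem TraceTendsto.tendsto_norm {u : ℕ → H →L[ℂ] H} {A : H →L[ℂ] H} (hu : TraceTendsto u A) :
    Tendsto u atTop (𝓝 A) := by
  rw [tendsto_iff_norm_sub_tendsto_zero]
  have h := (ENNReal.tendsto_toReal ENNReal.zero_ne_top).comp hu
  rw [ENNReal.toReal_zero] at h
  refine squeeze_zero' (Eventually.of_forall fun _ => norm_nonneg _) ?_ h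
  filter_upwards [hu.eventually (gt_mem_nhds one_pos)] with n hn
  exact norm_le_traceNorm (hn.trans ENNReal.one_lt_top).ne

/-- The part `(T - s)₊` of a positive operator `T` above the level `s`. -/
noncomputable def partAbove (s : ℝ) (T : H →L[ℂ] H) : H →L[ℂ] H :=
  cfc (fun x : ℝ => max (x - s) 0) T

theorem partAbove_nonneg (s : ℝ) (T : H →L[ℂ] H) : 0 ≤ partAbove s T :=
  cfc_nonneg fun _ _ => le_max_right _ _

theorem partAbove_le {s : ℝ} (hs : 0 ≤ s) {T : H →L[ℂ] H} (hT : 0 ≤ T) : partAbove s T ≤ T := by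
  have hTs := IsSelfAdjoint.of_nonneg hT
  conv_rhs => rw [← cfc_id' ℝ T]
  refine cfc_mono fun x hx => ?_
  have := spectrum_nonneg_of_nonneg hT hx
  exact max_le (by linarith) this

theorem le_partAbove_add {s : ℝ} {T : H →L[ℂ] H} (hT : 0 ≤ T) :
    T ≤ partAbove s T + algebraMap ℝ (H →L[ℂ] H) s := by
  have hTs := IsSelfAdjoint.of_nonneg hT
  rw [partAbove, ← cfc_const s T, ← cfc_add T (fun x : ℝ => max (x - s) 0) (fun _ => s)]
  conv_lhs => rw [← cfc_id' ℝ T]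
  refine cfc_mono fun x hx => ?_
  have := le_max_left (x - s) 0
  linarith

theorem partAbove_antitone {s t : ℝ} (hst : s ≤ t) (T : H →L[ℂ] H) :
    partAbove t T ≤ partAbove s T :=
  cfc_mono fun x _ => max_le_max (by linarith) le_rfl

/-- T is at least s wherever (T − s)₊ is nonzero. Hence ⟨Te, e⟩ ≥ s for every unit vector e in the
range of (T − s)₊. -/
theorem smul_partAbove_sq_le {s : ℝ} {T : H →L[ℂ] H} (hT : 0 ≤ T) :
    s • (partAbove s T * partAbove s T) ≤ partAbove s T * T * partAbove s T := by
  have hTs := IsSelfAdjoint.of_nonneg hT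
  have e : partAbove s T * T * partAbove s T
      = cfc (fun x : ℝ => max (x - s) 0 * x * max (x - s) 0) T := by
    rw [cfc_mul (fun x : ℝ => max (x - s) 0 * x) (fun x => max (x - s) 0) T,
      cfc_mul (fun x : ℝ => max (x - s) 0) (fun x => x) T, cfc_id' ℝ T]
    rfl
  have e2 : s • (partAbove s T * partAbove s T)
      = cfc (fun x : ℝ => s • (max (x - s) 0 * max (x - s) 0)) T := by
    rw [cfc_smul s (fun x : ℝ => max (x - s) 0 * max (x - s) 0) T,
      cfc_mul (fun x : ℝ => max (x - s) 0) (fun x => max (x - s) 0) T]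
    rfl
  rw [e, e2]
  refine cfc_mono fun x _ => ?_
  rw [smul_eq_mul]
  rcases le_total (x - s) 0 with h | h
  · simp [max_eq_right h]
  · rw [max_eq_left h]
    nlinarith [mul_nonneg h h]

/-- A Markov inequality: m + 1 orthonormal vectors in the range would each contribute at least s to
the trace of T. -/
theorem rankAtMost_partAbove {s : ℝ} {T : H →L[ℂ] H} (hT : 0 ≤ T) {m : ℕ}
    (h : posTrace T < ENNReal.ofReal ((m + 1) * s)) : RankAtMost (partAbove s T) m := by
  refine rankAtMost_of_forall_orthonormal fun e he hex => ?_
  have hFs : IsSelfAdjoint (partAbove s T) := IsSelfAdjoint.of_nonneg (partAbove_nonneg s T)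
  have key : ∀ i, s ≤ (inner ℂ (T (e i)) (e i)).re := by
    intro i
    obtain ⟨y, hy⟩ := hex i
    have h1 := re_inner_mono (smul_partAbove_sq_le (s := s) hT) y
    have swap : ∀ z, inner ℂ (partAbove s T z) y = inner ℂ z (partAbove s T y) := by
      intro z
      rw [← ContinuousLinearMap.adjoint_inner_right, ← ContinuousLinearMap.star_eq_adjoint,
        hFs.star_eq]
    rw [smul_apply, RCLike.real_smul_eq_coe_smul (K := ℂ), inner_smul_left, mul_apply_eq_comp,
      mul_apply_eq_comp, mul_apply_eq_comp, swap, swap, hy, inner_self_eq_norm_sq_to_K,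
      he.1 i] at h1
    simpa using h1
  refine absurd h (not_lt.2 (le_trans ?_ (sum_re_inner_le_posTrace hT he)))
  calc ENNReal.ofReal ((m + 1) * s) = ∑ _i : Fin (m + 1), ENNReal.ofReal s := by
        rw [Finset.sum_const, Finset.card_univ, Fintype.card_fin, nsmul_eq_mul,
          ENNReal.ofReal_mul (by positivity)]
        congr 1
        rw [← ENNReal.ofReal_natCast]
        push_cast
        rfl
    _ ≤ _ := Finset.sum_le_sum fun i _ => ENNReal.ofReal_le_ofReal (key i)

theorem exists_rankAtMost_partAbove {s : ℝ} (hs : 0 < s) : ∃ m : ℕ, ∀ T : H →L[ℂ] H,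
    0 ≤ T → posTrace T ≤ 1 → RankAtMost (partAbove s T) m := by
  obtain ⟨m, hm⟩ := exists_nat_gt s⁻¹
  refine ⟨m, fun T hT htr => rankAtMost_partAbove hT (htr.trans_lt ?_)⟩
  rw [← ENNReal.ofReal_one, ENNReal.ofReal_lt_ofReal_iff_of_nonneg zero_le_one]
  have h1 := (inv_lt_iff_one_lt_mul₀ hs).1 hm
  nlinarith

theorem tendsto_norm_partAbove (s : ℝ) {u : ℕ → H →L[ℂ] H} {A : H →L[ℂ] H}
    (hu : Tendsto u atTop (𝓝 A)) (hpos : ∀ n, 0 ≤ u n) (hA : 0 ≤ A) :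
    Tendsto (fun n => partAbove s (u n)) atTop (𝓝 (partAbove s A)) := by
  rcases subsingleton_or_nontrivial H with hH | hH
  · have : Subsingleton (H →L[ℂ] H) := ContinuousLinearMap.uniqueOfLeft.instSubsingleton
    exact tendsto_const_nhds.congr fun n => Subsingleton.elim _ _
  have hb : ∀ᶠ n in atTop, ‖u n‖ ≤ ‖A‖ + 1 :=
    (hu.norm.eventually (gt_mem_nhds (lt_add_one ‖A‖))).mono fun _ h => h.le
  refine Filter.Tendsto.cfc (isCompact_closedBall (0 : ℝ) (‖A‖ + 1)) _ hu ?_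
    (Eventually.of_forall fun n => IsSelfAdjoint.of_nonneg (hpos n)) ?_
    (IsSelfAdjoint.of_nonneg hA)
  · filter_upwards [hb] with n hn
    exact (spectrum.subset_closedBall_norm _).trans (Metric.closedBall_subset_closedBall hn)
  · exact (spectrum.subset_closedBall_norm _).trans
      (Metric.closedBall_subset_closedBall (by linarith))

/-- Continuity of the functional calculus gives operator-norm convergence; the differences have rank
at most 2m with m depending only on s, so their trace norms vanish too. -/
theorem traceTendsto_partAbove {s : ℝ} (hs : 0 < s) {u : ℕ → H →L[ℂ] H} {A : H →L[ℂ] H}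
    (hu : TraceTendsto u A) (hpos : ∀ n, 0 ≤ u n) (hA : 0 ≤ A) (htr : ∀ n, posTrace (u n) ≤ 1)
    (htrA : posTrace A ≤ 1) :
    TraceTendsto (fun n => partAbove s (u n)) (partAbove s A) := by
  obtain ⟨m, hm⟩ := exists_rankAtMost_partAbove (H := H) hs
  have h1 := tendsto_norm_partAbove s hu.tendsto_norm hpos hA
  rw [tendsto_iff_norm_sub_tendsto_zero] at h1
  have h2 := ENNReal.Tendsto.const_mul (a := ((m + m : ℕ) : ENNReal)) (ENNReal.tendsto_ofReal h1)
    (Or.inr (ENNReal.natCast_ne_top _))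
  rw [ENNReal.ofReal_zero, mul_zero] at h2
  refine tendsto_of_tendsto_of_tendsto_of_le_of_le tendsto_const_nhds h2 (fun _ => zero_le) ?_
  intro n
  have := posTrace_le_rank_mul_norm (CFC.abs_nonneg (partAbove s (u n) - partAbove s A))
    ((hm _ (hpos n) (htr n)).sub (hm _ hA htrA)).abs
  rwa [CFC.norm_abs] at this

/-- Dominated convergence on the diagonal: the entries of T − (T − s)₊ are at most s, and are
dominated by the summable entries of T. -/
theorem exists_posTrace_sub_partAbove_lt {T : H →L[ℂ] H} (hT : 0 ≤ T) (htr : posTrace T ≠ ⊤)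
    {η : ENNReal} (hη : 0 < η) :
    ∃ s : ℝ, 0 < s ∧ posTrace (T - partAbove s T) < η := by
  obtain ⟨w, b, -⟩ := exists_hilbertBasis ℂ H
  have hsum : ∑' i, ENNReal.ofReal (inner ℂ (T (b i)) (b i)).re ≠ ⊤ := by
    rwa [← posTrace_eq_tsum b hT]
  set t : ℕ → ℝ := fun k => 1 / ((k : ℝ) + 1)
  have ht : ∀ k, 0 < t k := fun k => by positivity
  have hnn : ∀ k, 0 ≤ T - partAbove (t k) T := fun k => sub_nonneg.2 (partAbove_le (ht k).le hT)
  have hx : ∀ k i, (inner ℂ ((T - partAbove (t k) T) (b i)) (b i)).re ≤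
      (inner ℂ (T (b i)) (b i)).re := fun k i =>
    re_inner_mono (sub_le_self T (partAbove_nonneg (t k) T)) (b i)
  have hy : ∀ k i, (inner ℂ ((T - partAbove (t k) T) (b i)) (b i)).re ≤ t k := by
    intro k i
    have h : T - partAbove (t k) T ≤ algebraMap ℝ (H →L[ℂ] H) (t k) :=
      sub_le_iff_le_add'.2 (le_partAbove_add hT)
    have := re_inner_mono h (b i)
    rwa [re_inner_algebraMap, b.orthonormal.1 i, one_pow, mul_one] at this
  have hlim : Tendsto (fun k => ∑' i, (inner ℂ ((T - partAbove (t k) T) (b i)) (b i)).re) atTop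
      (𝓝 (∑' _ : w, (0 : ℝ))) := by
    refine tendsto_tsum_of_dominated_convergence
      (bound := fun i => (inner ℂ (T (b i)) (b i)).re) ?_ (fun i => ?_)
      (Eventually.of_forall fun k i => ?_)
    · refine (ENNReal.summable_toReal hsum).congr fun i => ?_
      exact ENNReal.toReal_ofReal (re_inner_nonneg_of_nonneg hT _)
    · exact squeeze_zero (fun k => re_inner_nonneg_of_nonneg (hnn k) _) (fun k => hy k i)
        tendsto_one_div_add_atTop_nhds_zero_nat
    · rw [Real.norm_of_nonneg (re_inner_nonneg_of_nonneg (hnn k) _)]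
      exact hx k i
  rw [tsum_zero] at hlim
  have h2 := ENNReal.tendsto_ofReal hlim
  rw [ENNReal.ofReal_zero] at h2
  obtain ⟨k, hk⟩ := (h2.eventually (gt_mem_nhds hη)).exists
  refine ⟨t k, ht k, ?_⟩
  rw [posTrace_eq_tsum b (hnn k)]
  rwa [ENNReal.ofReal_tsum_of_nonneg (fun i => re_inner_nonneg_of_nonneg (hnn k) _)] at hk
  refine Summable.of_nonneg_of_le (fun i => re_inner_nonneg_of_nonneg (hnn k) _) (hx k) ?_
  refine (ENNReal.summable_toReal hsum).congr fun i => ?_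
  exact ENNReal.toReal_ofReal (re_inner_nonneg_of_nonneg hT _)

/-- A trace-convergent sequence of positive operators is approximated from below, uniformly in
trace, by a trace-convergent sequence of positive operators of bounded rank. -/
theorem exists_finiteRank_approx {T : ℕ → H →L[ℂ] H} (hT : ∀ n, 0 ≤ T n)
    (htr : ∀ n, posTrace (T n) ≤ 1) (hlim : TraceTendsto T (T 0)) {η : ENNReal} (hη : 0 < η) :
    ∃ (F : ℕ → H →L[ℂ] H) (m : ℕ), (∀ n, 0 ≤ F n) ∧ (∀ n, F n ≤ T n) ∧
      (∀ n, RankAtMost (F n) m) ∧ TraceTendsto F (F 0) ∧ ∀ n, posTrace (T n - F n) < η := by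
  have hfin : ∀ n, posTrace (T n) ≠ ⊤ := fun n => ((htr n).trans_lt ENNReal.one_lt_top).ne
  choose s hs hsη using fun n => exists_posTrace_sub_partAbove_lt (hT n) (hfin n) hη
  have hanti : ∀ n {a b : ℝ}, a ≤ b → posTrace (T n - partAbove b (T n)) < η →
      posTrace (T n - partAbove a (T n)) < η := fun n a b hab h =>
    (posTrace_mono (sub_le_sub_left (partAbove_antitone hab _) _)).trans_lt h
  have hev : ∀ᶠ n in atTop, posTrace (T n - partAbove (s 0) (T n)) < η := by
    have h1 := traceTendsto_partAbove (hs 0) hlim hT (hT 0) htr (htr 0)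
    have h2 := hlim.add (h1.const_smul (-1)) (fun n => .of_nonneg (hT n))
      (fun n => .smul (.all _) (.of_nonneg (partAbove_nonneg _ _))) (.of_nonneg (hT 0))
      (.smul (.all _) (.of_nonneg (partAbove_nonneg _ _)))
    simp only [neg_one_smul, ← sub_eq_add_neg] at h2
    exact (h2.tendsto_posTrace (fun n => sub_nonneg.2 (partAbove_le (hs 0).le (hT n)))
      (sub_nonneg.2 (partAbove_le (hs 0).le (hT 0)))).eventually (gt_mem_nhds (hsη 0))
  obtain ⟨N, hN⟩ := eventually_atTop.1 hev
  -- Beyond N the level chosen for the limit works; each n ≤ N has its own level. Lowering the level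
  -- only shrinks the remainder, so the minimum serves all n.
  set a := (Finset.range (N + 1)).inf' Finset.nonempty_range_add_one s with ha
  have ha0 : 0 < a := (Finset.lt_inf'_iff _).2 fun n _ => hs n
  obtain ⟨m, hm⟩ := exists_rankAtMost_partAbove (H := H) ha0
  refine ⟨fun n => partAbove a (T n), m, fun n => partAbove_nonneg _ _,
    fun n => partAbove_le ha0.le (hT n), fun n => hm _ (hT n) (htr n),
    traceTendsto_partAbove ha0 hlim hT (hT 0) htr (htr 0), fun n => ?_⟩
  rcases le_total N n with h | h
  · exact hanti n (Finset.inf'_le s (by simp)) (hN n h)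
  · exact hanti n (Finset.inf'_le s (Finset.mem_range.2 (by lia))) (hsη n)

end Truncation

/-! ### The homogeneous extension and its near additivity -/

section Homogeneous

set_option linter.unusedSectionVars false

variable {H : Type*} [NormedAddCommGroup H] [InnerProductSpace ℂ H] [CompleteSpace H]

/-- The real trace of a positive trace class operator. -/
noncomputable def opTrace (A : H →L[ℂ] H) : ℝ := (posTrace A).toReal

/-- The state proportional to a nonzero positive trace class operator. -/
noncomputable def normalizedState (A : H →L[ℂ] H) : H →L[ℂ] H := (opTrace A)⁻¹ • A

/-- The homogeneous extension of a function on states to positive trace class operators. -/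
noncomputable def homExt (f : (H →L[ℂ] H) → EReal) (A : H →L[ℂ] H) : ℝ :=
  opTrace A * (f (normalizedState A)).toReal

/-- A positive trace class operator which vanishes or is proportional to a state of `S` where `f`
is finite. -/
structure IsFiniteAt (f : (H →L[ℂ] H) → EReal) (S : Set (H →L[ℂ] H)) (A : H →L[ℂ] H) : Prop where
  nonneg : 0 ≤ A
  trace_ne_top : posTrace A ≠ ⊤
  mem : posTrace A ≠ 0 → normalizedState A ∈ S
  finite : posTrace A ≠ 0 → f (normalizedState A) ≠ ⊤

theorem opTrace_nonneg (A : H →L[ℂ] H) : 0 ≤ opTrace A := ENNReal.toReal_nonneg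

theorem opTrace_add {A B : H →L[ℂ] H} (hA : 0 ≤ A) (hB : 0 ≤ B) (hAt : posTrace A ≠ ⊤)
    (hBt : posTrace B ≠ ⊤) : opTrace (A + B) = opTrace A + opTrace B := by
  rw [opTrace, posTrace_add hA hB, ENNReal.toReal_add hAt hBt, opTrace, opTrace]

theorem opTrace_smul {r : ℝ} (hr : 0 ≤ r) (A : H →L[ℂ] H) : opTrace (r • A) = r * opTrace A := by
  rw [opTrace, posTrace_smul hr, ENNReal.toReal_mul, ENNReal.toReal_ofReal hr, opTrace]

theorem opTrace_pos {A : H →L[ℂ] H} (ht : posTrace A ≠ ⊤) (h0 : posTrace A ≠ 0) : 0 < opTrace A :=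
  ENNReal.toReal_pos h0 ht

theorem normalizedState_mem {A : H →L[ℂ] H} (hA : 0 ≤ A) (ht : posTrace A ≠ ⊤)
    (h0 : posTrace A ≠ 0) : normalizedState A ∈ quantumStates H := by
  have hp := opTrace_pos ht h0
  refine ⟨smul_nonneg (inv_nonneg.2 hp.le) hA, ?_⟩
  rw [normalizedState, posTrace_smul (inv_nonneg.2 hp.le), ENNReal.ofReal_inv_of_pos hp, opTrace,
    ENNReal.ofReal_toReal ht, ENNReal.inv_mul_cancel h0 ht]

theorem opTrace_of_mem {ω : H →L[ℂ] H} (h : ω ∈ quantumStates H) : opTrace ω = 1 := by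
  simp [opTrace, h.2]

theorem normalizedState_of_mem {ω : H →L[ℂ] H} (h : ω ∈ quantumStates H) :
    normalizedState ω = ω := by
  rw [normalizedState, opTrace_of_mem h, inv_one, one_smul]

theorem homExt_of_mem (f : (H →L[ℂ] H) → EReal) {ω : H →L[ℂ] H} (h : ω ∈ quantumStates H) :
    homExt f ω = (f ω).toReal := by
  rw [homExt, opTrace_of_mem h, normalizedState_of_mem h, one_mul]

theorem homExt_zero (f : (H →L[ℂ] H) → EReal) : homExt f 0 = 0 := by
  simp [homExt, opTrace, posTrace_zero]

theorem isFiniteAt_zero (f : (H →L[ℂ] H) → EReal) (S : Set (H →L[ℂ] H)) : IsFiniteAt f S 0 :=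
  ⟨le_rfl, by simp [posTrace_zero], fun h => (h posTrace_zero).elim,
    fun h => (h posTrace_zero).elim⟩

theorem normalizedState_smul {r : ℝ} (hr : 0 < r) (A : H →L[ℂ] H) :
    normalizedState (r • A) = normalizedState A := by
  rw [normalizedState, opTrace_smul hr.le, smul_smul, normalizedState]
  congr 1
  rw [mul_inv, mul_comm r⁻¹, mul_assoc, inv_mul_cancel₀ hr.ne', mul_one]

theorem homExt_smul (f : (H →L[ℂ] H) → EReal) {r : ℝ} (hr : 0 ≤ r) (A : H →L[ℂ] H) :
    homExt f (r • A) = r * homExt f A := by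
  rcases hr.eq_or_lt with rfl | hr
  · rw [zero_smul, homExt_zero, zero_mul]
  · rw [homExt, normalizedState_smul hr, opTrace_smul hr.le, homExt, mul_assoc]

theorem IsFiniteAt.smul {f : (H →L[ℂ] H) → EReal} {S : Set (H →L[ℂ] H)} {A : H →L[ℂ] H}
    (h : IsFiniteAt f S A) {r : ℝ} (hr : 0 ≤ r) : IsFiniteAt f S (r • A) := by
  rcases hr.eq_or_lt with rfl | hr
  · rw [zero_smul]; exact isFiniteAt_zero f S
  · have h0 : posTrace (r • A) ≠ 0 → posTrace A ≠ 0 := by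
      intro h1 h2
      rw [posTrace_smul hr.le, h2, mul_zero] at h1
      exact h1 rfl
    refine ⟨smul_nonneg hr.le h.nonneg, ?_, fun h1 => ?_, fun h1 => ?_⟩
    · rw [posTrace_smul hr.le]
      exact ENNReal.mul_ne_top ENNReal.ofReal_ne_top h.trace_ne_top
    · rw [normalizedState_smul hr]; exact h.mem (h0 h1)
    · rw [normalizedState_smul hr]; exact h.finite (h0 h1)

/-- `w` bounds the deviation of `f` from affinity on `S`. -/
structure IsAffinityModulus (f : (H →L[ℂ] H) → EReal) (S : Set (H →L[ℂ] H)) (w : ℝ → ℝ) :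
    Prop where
  tendsto : Tendsto w (𝓝[>] 0) (𝓝 0)
  monotone : MonotoneOn w (Ioc 0 (1 / 2))
  nonneg : ∀ p ∈ Ioc (0 : ℝ) (1 / 2), 0 ≤ w p
  lower : ∀ ρ ∈ S, ∀ σ ∈ S, ∀ p ∈ Ioc (0 : ℝ) (1 / 2),
    (p : EReal) * f ρ + ((1 - p : ℝ) : EReal) * f σ - (w p : EReal) ≤ f (p • ρ + (1 - p) • σ)
  upper : ∀ ρ ∈ S, ∀ σ ∈ S, ∀ p ∈ Ioc (0 : ℝ) (1 / 2),
    f (p • ρ + (1 - p) • σ) ≤ (p : EReal) * f ρ + ((1 - p : ℝ) : EReal) * f σ + (w p : EReal)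

theorem LocallyAlmostAffineOn.exists_isAffinityModulus {f : (H →L[ℂ] H) → EReal}
    {S : Set (H →L[ℂ] H)} (h : LocallyAlmostAffineOn f S) : ∃ w, IsAffinityModulus f S w := by
  obtain ⟨a, b, ha, hb, hma, hmb, hab⟩ := h
  have ht : Tendsto (fun p => max (a p) (b p)) (𝓝[>] 0) (𝓝 0) := by
    simpa using ha.max hb
  have hsub : Ioc (0 : ℝ) (1 / 2) ⊆ Icc 0 (1 / 2) := Ioc_subset_Icc_self
  have hm : MonotoneOn (fun p => max (a p) (b p)) (Ioc 0 (1 / 2)) := fun x hx y hy hxy =>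
    max_le_max (hma (hsub hx) (hsub hy) hxy) (hmb (hsub hx) (hsub hy) hxy)
  refine ⟨fun p => max (a p) (b p), ht, hm, fun p hp => ?_, fun ρ hρ σ hσ p hp => ?_,
    fun ρ hρ σ hσ p hp => ?_⟩
  -- A nondecreasing function with limit 0 at 0⁺ is nonnegative.
  · refine le_of_tendsto ht ?_
    filter_upwards [Ioc_mem_nhdsGT hp.1] with x hx
    exact hm ⟨hx.1, hx.2.trans hp.2⟩ hp hx.2
  · refine le_trans (EReal.sub_le_sub le_rfl ?_)
      (hab ρ hρ σ hσ p ⟨hp.1.le, hp.2.trans (by norm_num)⟩).1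
    exact_mod_cast le_max_left _ _
  · refine (hab ρ hρ σ hσ p ⟨hp.1.le, hp.2.trans (by norm_num)⟩).2.trans (add_le_add le_rfl ?_)
    exact_mod_cast le_max_right _ _

variable {f : (H →L[ℂ] H) → EReal} {S : Set (H →L[ℂ] H)} {w : ℝ → ℝ}

theorem IsAffinityModulus.mix (hw : IsAffinityModulus f S w) (hconv : Convex ℝ S)
    (hf : ∀ ω ∈ S, 0 ≤ f ω) {ρ σ : H →L[ℂ] H} (hρ : ρ ∈ S) (hσ : σ ∈ S) (hρf : f ρ ≠ ⊤)
    (hσf : f σ ≠ ⊤) {p : ℝ} (hp : p ∈ Ioc (0 : ℝ) (1 / 2)) :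
    f (p • ρ + (1 - p) • σ) ≠ ⊤ ∧
      |(f (p • ρ + (1 - p) • σ)).toReal - (p * (f ρ).toReal + (1 - p) * (f σ).toReal)| ≤ w p := by
  have hbot : ∀ ω ∈ S, f ω ≠ ⊥ := fun ω hω => (EReal.bot_lt_zero.trans_le (hf ω hω)).ne'
  have hmem : p • ρ + (1 - p) • σ ∈ S :=
    hconv hρ hσ hp.1.le (by linarith [hp.2]) (by ring)
  have h1 := hw.lower ρ hρ σ hσ p hp
  have h2 := hw.upper ρ hρ σ hσ p hp
  have hz := hbot _ hmem
  generalize f (p • ρ + (1 - p) • σ) = z at h1 h2 hz ⊢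
  lift f ρ to ℝ using ⟨hρf, hbot ρ hρ⟩ with x
  lift f σ to ℝ using ⟨hσf, hbot σ hσ⟩ with y
  have hzt : z ≠ ⊤ := ne_top_of_le_ne_top (by exact_mod_cast EReal.coe_ne_top _) h2
  refine ⟨hzt, ?_⟩
  lift z to ℝ using ⟨hzt, hz⟩
  norm_cast at h1 h2
  simp only [EReal.toReal_coe]
  rw [abs_le]
  constructor <;> linarith

theorem IsFiniteAt.homExt_nonneg {A : H →L[ℂ] H} (hA : IsFiniteAt f S A)
    (hf : ∀ ω ∈ S, 0 ≤ f ω) : 0 ≤ homExt f A := by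
  by_cases h : posTrace A = 0
  · rw [eq_zero_of_posTrace_eq_zero hA.nonneg h, homExt_zero]
  · exact mul_nonneg (opTrace_nonneg A) (EReal.toReal_nonneg (hf _ (hA.mem h)))

/-- The normalized sum is the mixture of the normalized summands with weight p = Tr A / Tr(A + B) ≤
q; multiply the almost affine estimate by Tr(A + B) and use w(p) ≤ w(q). -/
theorem IsAffinityModulus.homExt_add (hw : IsAffinityModulus f S w) (hconv : Convex ℝ S)
    (hf : ∀ ω ∈ S, 0 ≤ f ω) {A B : H →L[ℂ] H} (hA : IsFiniteAt f S A) (hB : IsFiniteAt f S B)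
    {q : ℝ} (hq : q ∈ Ioc (0 : ℝ) (1 / 2)) (h : opTrace A ≤ q * (opTrace A + opTrace B)) :
    IsFiniteAt f S (A + B) ∧
      |homExt f (A + B) - (homExt f A + homExt f B)| ≤ (opTrace A + opTrace B) * w q := by
  have hA0 := opTrace_nonneg A
  have hB0 := opTrace_nonneg B
  by_cases hAz : posTrace A = 0
  · rw [eq_zero_of_posTrace_eq_zero hA.nonneg hAz, zero_add, homExt_zero, zero_add, sub_self,
      abs_zero]
    exact ⟨hB, mul_nonneg (add_nonneg (opTrace_nonneg _) hB0) (hw.nonneg q hq)⟩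
  have hAp := opTrace_pos hA.trace_ne_top hAz
  have hBp : 0 < opTrace B := by
    by_contra hlt
    have : opTrace B = 0 := le_antisymm (not_lt.1 hlt) hB0
    rw [this, add_zero] at h
    nlinarith [hq.2]
  have hBz : posTrace B ≠ 0 := fun h0 => by simp [opTrace, h0] at hBp
  have hadd := opTrace_add hA.nonneg hB.nonneg hA.trace_ne_top hB.trace_ne_top
  set x := opTrace A
  set y := opTrace B
  set p := x / (x + y) with hpdef
  have hxy : 0 < x + y := by linarith
  have hpq : p ≤ q := (div_le_iff₀ hxy).2 h
  have hp : p ∈ Ioc (0 : ℝ) (1 / 2) := ⟨div_pos hAp hxy, hpq.trans hq.2⟩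
  have h1p : 1 - p = y / (x + y) := by rw [hpdef]; field_simp; ring
  have hnorm : normalizedState (A + B) =
      p • normalizedState A + (1 - p) • normalizedState B := by
    rw [h1p, normalizedState, normalizedState, normalizedState, hadd, smul_smul, smul_smul,
      smul_add]
    congr 2
    · rw [hpdef]; change _ = x / (x + y) * x⁻¹; field_simp
    · change _ = y / (x + y) * y⁻¹; field_simp
  obtain ⟨hfin, habs⟩ := hw.mix hconv hf (hA.mem hAz) (hB.mem hBz) (hA.finite hAz)
    (hB.finite hBz) hp
  have hmem := hconv (hA.mem hAz) (hB.mem hBz) hp.1.le (by linarith [hp.2] : 0 ≤ 1 - p) (by ring)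
  rw [← hnorm] at hfin habs hmem
  refine ⟨⟨add_nonneg hA.nonneg hB.nonneg, ?_, fun _ => hmem, fun _ => hfin⟩, ?_⟩
  · rw [posTrace_add hA.nonneg hB.nonneg]
    exact ENNReal.add_ne_top.2 ⟨hA.trace_ne_top, hB.trace_ne_top⟩
  · have e : homExt f (A + B) - (homExt f A + homExt f B) = (x + y) *
        ((f (normalizedState (A + B))).toReal - (p * (f (normalizedState A)).toReal +
          (1 - p) * (f (normalizedState B)).toReal)) := by
      rw [h1p, homExt, homExt, homExt, hadd]
      change (x + y) * _ - (x * _ + y * _) = _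
      rw [hpdef]
      field_simp
    rw [e, abs_mul, abs_of_pos hxy]
    exact mul_le_mul_of_nonneg_left (habs.trans (hw.monotone hp hq hpq)) hxy.le

theorem IsAffinityModulus.homExt_add_half (hw : IsAffinityModulus f S w) (hconv : Convex ℝ S)
    (hf : ∀ ω ∈ S, 0 ≤ f ω) {A B : H →L[ℂ] H} (hA : IsFiniteAt f S A) (hB : IsFiniteAt f S B) :
    IsFiniteAt f S (A + B) ∧
      |homExt f (A + B) - (homExt f A + homExt f B)| ≤
        (opTrace A + opTrace B) * w (1 / 2) := by
  have hq : (1 / 2 : ℝ) ∈ Ioc (0 : ℝ) (1 / 2) := by norm_num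
  rcases le_total (opTrace A) (opTrace B) with h | h
  · exact hw.homExt_add hconv hf hA hB hq (by linarith)
  · have := hw.homExt_add hconv hf hB hA hq (by linarith)
    rwa [add_comm B, add_comm (homExt f B), add_comm (opTrace B)] at this

theorem isFiniteAt_of_mem (hS : S ⊆ quantumStates H) {ω : H →L[ℂ] H} (h : ω ∈ S)
    (hfin : f ω ≠ ⊤) : IsFiniteAt f S ω := by
  have hω := hS h
  refine ⟨hω.1, by simp [hω.2], fun _ => ?_, fun _ => ?_⟩ <;>
  rwa [normalizedState_of_mem hω]

theorem LocallyAlmostAffineOn.ne_top_of_mix (hLAA : LocallyAlmostAffineOn f S)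
    (hf : ∀ ω ∈ S, 0 ≤ f ω) {ρ σ : H →L[ℂ] H} (hρ : ρ ∈ S) (hσ : σ ∈ S) {p : ℝ} (hp0 : 0 < p)
    (hp1 : p < 1) (h : f (p • ρ + (1 - p) • σ) ≠ ⊤) : f ρ ≠ ⊤ := by
  obtain ⟨a, b, -, -, -, -, hab⟩ := hLAA
  have h1 := (hab ρ hρ σ hσ p ⟨hp0.le, hp1.le⟩).1
  intro htop
  refine h (top_le_iff.1 (le_trans (le_of_eq ?_) h1))
  rw [htop, EReal.mul_top_of_pos (by exact_mod_cast hp0), EReal.top_add_of_ne_bot,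
    EReal.top_sub_coe]
  exact (EReal.bot_lt_zero.trans_le
    (mul_nonneg (by exact_mod_cast (sub_pos.2 hp1).le) (hf σ hσ))).ne'

/-- The normalization ω of A is a component of τ: τ = pω + (1 − p)σ with p > 0 and σ again dominated
by a multiple of τ. As f(σ) ≥ 0, the lower almost affine bound would make f(τ) infinite if f(ω)
were. -/
theorem LocallyAlmostAffineOn.isFiniteAt_of_le (hLAA : LocallyAlmostAffineOn f S)
    (hS : S ⊆ quantumStates H) (hf : ∀ ω ∈ S, 0 ≤ f ω) {τ : H →L[ℂ] H} (hτ : τ ∈ S)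
    (hfτ : f τ ≠ ⊤) (hher : ∀ ω ∈ quantumStates H, (∃ t : ℝ, ω ≤ t • τ) → ω ∈ S)
    {A : H →L[ℂ] H} (hA : 0 ≤ A) {t : ℝ} (ht : A ≤ t • τ) : IsFiniteAt f S A := by
  have hτq := hS hτ
  have hτt : ∀ t : ℝ, 0 ≤ t → posTrace (t • τ) ≠ ⊤ := fun t ht => by
    rw [posTrace_smul ht, hτq.2, mul_one]; exact ENNReal.ofReal_ne_top
  have hmono : ∀ {s t : ℝ}, s ≤ t → s • τ ≤ t • τ := fun h => smul_le_smul_of_nonneg_right h hτq.1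
  have htr : posTrace A ≠ ⊤ := ne_top_of_le_ne_top (hτt |t| (abs_nonneg t))
    (posTrace_mono (ht.trans (hmono (le_abs_self t))))
  have hmem : posTrace A ≠ 0 → normalizedState A ∈ S ∧ f (normalizedState A) ≠ ⊤ := by
    intro h0
    have hω := normalizedState_mem hA htr h0
    have hωt : normalizedState A ≤ ((opTrace A)⁻¹ * t) • τ := by
      rw [mul_smul]
      exact smul_le_smul_of_nonneg_left ht (inv_nonneg.2 (opTrace_nonneg A))
    have hωS := hher _ hω ⟨_, hωt⟩
    refine ⟨hωS, ?_⟩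
    -- The sign of t is unrestricted; adding 2 makes p = 1/r at most 1/2, so σ has positive weight.
    set r := |(opTrace A)⁻¹ * t| + 2
    have hr : 2 ≤ r := by linarith [abs_nonneg ((opTrace A)⁻¹ * t)]
    have hr0 : 0 < r := by linarith
    have hωr : normalizedState A ≤ r • τ :=
      hωt.trans (hmono ((le_abs_self _).trans (by simp [r])))
    set p := r⁻¹
    have hp0 : 0 < p := inv_pos.2 hr0
    have hp1 : p < 1 := inv_lt_one_of_one_lt₀ (by linarith)
    set D := τ - p • normalizedState A with hD
    have hD0 : 0 ≤ D := by
      have := smul_le_smul_of_nonneg_left hωr hp0.le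
      rw [smul_smul, inv_mul_cancel₀ hr0.ne', one_smul] at this
      exact sub_nonneg.2 this
    have hpω : 0 ≤ p • normalizedState A := smul_nonneg hp0.le hω.1
    have hDadd := posTrace_add hD0 hpω
    rw [hD, sub_add_cancel, hτq.2, posTrace_smul hp0.le, hω.2, mul_one, ← hD] at hDadd
    have hDt : posTrace D ≠ ⊤ := fun h => by
      rw [h, top_add] at hDadd; exact ENNReal.one_ne_top hDadd
    have hDtr : opTrace D = 1 - p := by
      have := congrArg ENNReal.toReal hDadd
      rw [ENNReal.toReal_add hDt ENNReal.ofReal_ne_top, ENNReal.toReal_one,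
        ENNReal.toReal_ofReal hp0.le] at this
      rw [opTrace]; linarith
    have hDz : posTrace D ≠ 0 := fun h => by
      rw [opTrace, h] at hDtr; simp at hDtr; linarith
    have hσ := normalizedState_mem hD0 hDt hDz
    have hσS : normalizedState D ∈ S := by
      refine hher _ hσ ⟨(1 - p)⁻¹, ?_⟩
      rw [normalizedState, hDtr]
      exact smul_le_smul_of_nonneg_left (sub_le_self τ hpω) (inv_nonneg.2 (by linarith))
    refine hLAA.ne_top_of_mix hf hωS hσS hp0 hp1 ?_
    have hDn : (1 - p) • normalizedState D = D := by
      rw [normalizedState, hDtr, smul_smul, mul_inv_cancel₀ (sub_pos.2 hp1).ne', one_smul]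
    rwa [hDn, hD, add_sub_cancel]
  exact ⟨hA, htr, fun h => (hmem h).1, fun h => (hmem h).2⟩

theorem TraceTendsto.tendsto_opTrace {u : ℕ → H →L[ℂ] H} {A : H →L[ℂ] H} (hu : TraceTendsto u A)
    (hpos : ∀ n, 0 ≤ u n) (hA : 0 ≤ A) (hAt : posTrace A ≠ ⊤) :
    Tendsto (fun n => opTrace (u n)) atTop (𝓝 (opTrace A)) :=
  (ENNReal.tendsto_toReal hAt).comp (hu.tendsto_posTrace hpos hA)

theorem TraceTendsto.normalizedState {u : ℕ → H →L[ℂ] H} {A : H →L[ℂ] H} (hu : TraceTendsto u A)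
    (hpos : ∀ n, 0 ≤ u n) (hA : 0 ≤ A) (hAt : posTrace A ≠ ⊤) (hA0 : posTrace A ≠ 0) :
    TraceTendsto (fun n => normalizedState (u n)) (normalizedState A) :=
  hu.smul (fun n => .of_nonneg (hpos n)) (.of_nonneg hA) (by rwa [traceNorm_of_nonneg hA])
    ((hu.tendsto_opTrace hpos hA hAt).inv₀ (opTrace_pos hAt hA0).ne')

theorem TraceLowerSemicontinuousOn.eventually_lt (hlsc : TraceLowerSemicontinuousOn f S)
    {u : ℕ → H →L[ℂ] H} {A : H →L[ℂ] H} (hu : TraceTendsto u A) (huS : ∀ᶠ n in atTop, u n ∈ S)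
    (hA : A ∈ S) {y : EReal} (hy : y < f A) : ∀ᶠ n in atTop, y < f (u n) := by
  obtain ⟨δ, hδ, h⟩ := hlsc A hA y hy
  filter_upwards [huS, Tendsto.eventually hu (gt_mem_nhds hδ)] with n h1 h2
  exact h _ h1 h2

/-- At a nonzero limit normalization is continuous, so lower semicontinuity of f carries over; at a
zero limit nonnegativity of f suffices. -/
theorem TraceLowerSemicontinuousOn.eventually_homExt (hlsc : TraceLowerSemicontinuousOn f S)
    (hf : ∀ ω ∈ S, 0 ≤ f ω) {u : ℕ → H →L[ℂ] H} {A : H →L[ℂ] H} (hu : TraceTendsto u A)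
    (hfu : ∀ n, IsFiniteAt f S (u n)) (hfA : IsFiniteAt f S A) {η : ℝ} (hη : 0 < η) :
    ∀ᶠ n in atTop, homExt f A - η ≤ homExt f (u n) := by
  by_cases hz : posTrace A = 0
  · rw [eq_zero_of_posTrace_eq_zero hfA.nonneg hz, homExt_zero]
    exact Eventually.of_forall fun n => by linarith [(hfu n).homExt_nonneg hf]
  have hbot : ∀ ω ∈ S, f ω ≠ ⊥ := fun ω hω => (EReal.bot_lt_zero.trans_le (hf ω hω)).ne'
  have ht := opTrace_pos hfA.trace_ne_top hz
  have htr := hu.tendsto_opTrace (fun n => (hfu n).nonneg) hfA.nonneg hfA.trace_ne_top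
  have hne : ∀ᶠ n in atTop, posTrace (u n) ≠ 0 := by
    filter_upwards [htr.eventually (lt_mem_nhds ht)] with n hn h0
    simp [opTrace, h0] at hn
  set x := (f (normalizedState A)).toReal
  set δ := η / (2 * opTrace A)
  have hδ : 0 < δ := by positivity
  have h1 : ((x - δ : ℝ) : EReal) < f (normalizedState A) := by
    rw [← EReal.coe_toReal (hfA.finite hz) (hbot _ (hfA.mem hz))]
    exact_mod_cast sub_lt_self x hδ
  have h2 := hlsc.eventually_lt
    (hu.normalizedState (fun n => (hfu n).nonneg) hfA.nonneg hfA.trace_ne_top hz)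
    (hne.mono fun n h => (hfu n).mem h) (hfA.mem hz) h1
  have h3 : ∀ᶠ n in atTop, opTrace A * x - η < opTrace (u n) * (x - δ) := by
    refine (htr.mul_const (x - δ)).eventually (lt_mem_nhds ?_)
    have : opTrace A * δ = η / 2 := by simp only [δ]; field_simp
    rw [mul_sub, this]
    linarith
  filter_upwards [h2, h3, hne] with n a1 a2 a3
  rw [← EReal.coe_toReal ((hfu n).finite a3) (hbot _ ((hfu n).mem a3))] at a1
  have a4 : x - δ < (f (normalizedState (u n))).toReal := by exact_mod_cast a1
  calc homExt f A - η = opTrace A * x - η := rfl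
    _ ≤ opTrace (u n) * (x - δ) := a2.le
    _ ≤ homExt f (u n) := mul_le_mul_of_nonneg_left a4.le (opTrace_nonneg _)

end Homogeneous

/-! ### Upper semicontinuity at bounded rank, for f bounded on pure states -/

section FiniteRankContinuity

set_option linter.unusedSectionVars false

variable {H : Type*} [NormedAddCommGroup H] [InnerProductSpace ℂ H] [CompleteSpace H]
  {f : (H →L[ℂ] H) → EReal} {S : Set (H →L[ℂ] H)} {w : ℝ → ℝ}

theorem opTrace_rankOne (v : H) : opTrace (InnerProductSpace.rankOne ℂ v v) = ‖v‖ ^ 2 := by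
  rw [opTrace, posTrace_rankOne, ENNReal.toReal_ofReal (by positivity)]

theorem rankOne_bound (hfin : ∀ ω ∈ quantumStates H, (∃ m : ℕ, RankAtMost ω m) → ω ∈ S)
    (hf : ∀ ω ∈ S, 0 ≤ f ω) {C : ℝ}
    (hC : ∀ φ : H, ‖φ‖ = 1 → f (InnerProductSpace.rankOne ℂ φ φ) ≤ C) (v : H) :
    IsFiniteAt f S (InnerProductSpace.rankOne ℂ v v) ∧
      homExt f (InnerProductSpace.rankOne ℂ v v) ≤ C * ‖v‖ ^ 2 := by
  rcases eq_or_ne v 0 with rfl | hv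
  · simp only [map_zero, homExt_zero, norm_zero]
    exact ⟨isFiniteAt_zero f S, by simp⟩
  have hvp : 0 < ‖v‖ := norm_pos_iff.2 hv
  set φ : H := ((‖v‖⁻¹ : ℝ) : ℂ) • v
  have hφ : ‖φ‖ = 1 := by
    rw [norm_smul, Complex.norm_real, norm_inv, norm_norm, inv_mul_cancel₀ hvp.ne']
  have hn : normalizedState (InnerProductSpace.rankOne ℂ v v) =
      InnerProductSpace.rankOne ℂ φ φ := by
    ext x
    rw [normalizedState, opTrace_rankOne, smul_apply, InnerProductSpace.rankOne_apply,
      InnerProductSpace.rankOne_apply, inner_smul_left, smul_smul, Complex.conj_ofReal,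
      RCLike.real_smul_eq_coe_smul (K := ℂ), smul_smul]
    congr 1
    push_cast
    simp
    ring
  have ht : posTrace (InnerProductSpace.rankOne ℂ v v) ≠ ⊤ := by
    rw [posTrace_rankOne]; exact ENNReal.ofReal_ne_top
  have hφS : InnerProductSpace.rankOne ℂ φ φ ∈ S := by
    refine hfin _ ⟨rankOne_self_nonneg φ, ?_⟩ ⟨1, rankAtMost_rankOne φ φ⟩
    rw [posTrace_rankOne, hφ]; simp
  have hft : f (InnerProductSpace.rankOne ℂ φ φ) ≠ ⊤ :=
    ne_top_of_le_ne_top (EReal.coe_ne_top C) (hC φ hφ)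
  refine ⟨⟨rankOne_self_nonneg v, ht, fun _ => hn ▸ hφS, fun _ => hn ▸ hft⟩, ?_⟩
  rw [homExt, hn, opTrace_rankOne, mul_comm]
  refine mul_le_mul_of_nonneg_right ?_ (by positivity)
  have := EReal.toReal_le_toReal (hC φ hφ)
    (EReal.bot_lt_zero.trans_le (hf _ hφS)).ne' (EReal.coe_ne_top C)
  simpa using this

/-- Add the rank-one summands one at a time; each addition costs at most w(1/2) times the current
trace. -/
theorem IsAffinityModulus.finiteRank_bound (hw : IsAffinityModulus f S w) (hconv : Convex ℝ S)
    (hfin : ∀ ω ∈ quantumStates H, (∃ m : ℕ, RankAtMost ω m) → ω ∈ S)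
    (hf : ∀ ω ∈ S, 0 ≤ f ω) {C : ℝ}
    (hC : ∀ φ : H, ‖φ‖ = 1 → f (InnerProductSpace.rankOne ℂ φ φ) ≤ C) {A : H →L[ℂ] H}
    (hA : 0 ≤ A) {m : ℕ} (hm : RankAtMost A m) :
    IsFiniteAt f S A ∧ homExt f A ≤ (C + m * w (1 / 2)) * opTrace A := by
  classical
  obtain ⟨n, hn, v, rfl⟩ := exists_eq_sum_rankOne hA hm
  have hw0 : 0 ≤ w (1 / 2) := hw.nonneg _ (by norm_num)
  have key : ∀ s : Finset (Fin n),
      IsFiniteAt f S (∑ i ∈ s, InnerProductSpace.rankOne ℂ (v i) (v i)) ∧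
      homExt f (∑ i ∈ s, InnerProductSpace.rankOne ℂ (v i) (v i)) ≤ (C + s.card * w (1 / 2)) *
        opTrace (∑ i ∈ s, InnerProductSpace.rankOne ℂ (v i) (v i)) := by
    intro s
    induction s using Finset.induction_on with
    | empty =>
      simp only [Finset.sum_empty]
      exact ⟨isFiniteAt_zero f S, by simp [homExt_zero, opTrace, posTrace_zero]⟩
    | insert i s hi ih =>
      rw [Finset.sum_insert hi, Finset.card_insert_of_notMem hi]
      obtain ⟨h1, h2⟩ := rankOne_bound hfin hf hC (v i)
      obtain ⟨h3, h4⟩ := ih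
      obtain ⟨h5, h6⟩ := hw.homExt_add_half hconv hf h1 h3
      refine ⟨h5, ?_⟩
      rw [opTrace_add h1.nonneg h3.nonneg h1.trace_ne_top h3.trace_ne_top]
      rw [← opTrace_rankOne] at h2
      have h7 := (abs_le.1 h6).2
      have h8 := mul_nonneg (mul_nonneg (Nat.cast_nonneg (α := ℝ) s.card) hw0)
        (opTrace_nonneg (InnerProductSpace.rankOne ℂ (v i) (v i)))
      push_cast
      nlinarith
  obtain ⟨h1, h2⟩ := key Finset.univ
  refine ⟨h1, h2.trans ?_⟩
  rw [Finset.card_univ, Fintype.card_fin]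
  refine mul_le_mul_of_nonneg_right ?_ (opTrace_nonneg _)
  have : (n : ℝ) ≤ m := by exact_mod_cast hn
  nlinarith

/-- With D = uₙ − A, split uₙ + (|D| − D) = A + |D| on both sides. The added terms are positive, of
bounded rank and of small trace: F(|D| − D) ≥ 0 can be dropped, and F(|D|) is at most a constant
times Tr |D|. -/
theorem IsAffinityModulus.eventually_homExt_le (hw : IsAffinityModulus f S w)
    (hconv : Convex ℝ S) (hfin : ∀ ω ∈ quantumStates H, (∃ m : ℕ, RankAtMost ω m) → ω ∈ S)
    (hf : ∀ ω ∈ S, 0 ≤ f ω) {C : ℝ}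
    (hC : ∀ φ : H, ‖φ‖ = 1 → f (InnerProductSpace.rankOne ℂ φ φ) ≤ C) {u : ℕ → H →L[ℂ] H}
    {A : H →L[ℂ] H} {m : ℕ} (hu : TraceTendsto u A) (hpos : ∀ n, 0 ≤ u n) (hA : 0 ≤ A)
    (hum : ∀ n, RankAtMost (u n) m) (hAm : RankAtMost A m) (hA0 : posTrace A ≠ 0)
    {η : ℝ} (hη : 0 < η) : ∀ᶠ n in atTop, homExt f (u n) ≤ homExt f A + η := by
  have hbd : ∀ {B : H →L[ℂ] H} {k : ℕ}, 0 ≤ B → RankAtMost B k →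
      IsFiniteAt f S B ∧ homExt f B ≤ (C + k * w (1 / 2)) * opTrace B := fun h1 h2 =>
    hw.finiteRank_bound hconv hfin hf hC h1 h2
  have hAf := (hbd hA hAm).1
  have hAp := opTrace_pos hAf.trace_ne_top hA0
  -- T bounds Tr A + Tr |D| once Tr |D| < 1; the two splitting errors are then at most η/4 each,
  -- leaving η/2 for F(|D|).
  set T := opTrace A + 1
  have hT : 0 < T := by positivity
  obtain ⟨q, hqw, hq⟩ := ((hw.tendsto.eventually (gt_mem_nhds
    (show (0 : ℝ) < η / (4 * T) by positivity))).and
    (Ioc_mem_nhdsGT (by norm_num : (0 : ℝ) < 1 / 2))).exists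
  set M := C + (m + m : ℕ) * w (1 / 2)
  have htr : Tendsto (fun n => opTrace (CFC.abs (u n - A))) atTop (𝓝 0) :=
    (ENNReal.tendsto_toReal ENNReal.zero_ne_top).comp hu
  have hM : Tendsto (fun n => M * opTrace (CFC.abs (u n - A))) atTop (𝓝 0) := by
    simpa using htr.const_mul M
  filter_upwards [htr.eventually (gt_mem_nhds one_pos),
    htr.eventually (gt_mem_nhds (show 0 < q * opTrace A / 2 from
      div_pos (mul_pos hq.1 hAp) two_pos)),
    hM.eventually (gt_mem_nhds (half_pos hη))] with n h1 h2 h3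
  have hD : IsSelfAdjoint (u n - A) := isSelfAdjoint_of_sub (hpos n) hA
  set D := u n - A
  have hE0 : 0 ≤ CFC.abs D := CFC.abs_nonneg D
  have hDm : RankAtMost D (m + m) := (hum n).sub hAm
  have hP0 : 0 ≤ CFC.abs D - D := sub_nonneg.2 (self_le_abs hD)
  obtain ⟨hEf, hEb⟩ := hbd hE0 hDm.abs
  obtain ⟨hPf, -⟩ := hbd hP0 (hDm.abs.sub hDm)
  obtain ⟨huf, -⟩ := hbd (hpos n) (hum n)
  have hsum : (CFC.abs D - D) + u n = CFC.abs D + A := by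
    simp only [D]; abel
  have htrs := congrArg opTrace hsum
  rw [opTrace_add hP0 (hpos n) hPf.trace_ne_top huf.trace_ne_top,
    opTrace_add hE0 hA hEf.trace_ne_top hAf.trace_ne_top] at htrs
  have hEn := opTrace_nonneg (CFC.abs D)
  have hP2 : opTrace (CFC.abs D - D) ≤ 2 * opTrace (CFC.abs D) := by
    rw [← opTrace_smul (by norm_num)]
    refine ENNReal.toReal_mono (hEf.smul (by norm_num)).trace_ne_top (posTrace_mono ?_)
    rw [two_smul, sub_le_iff_le_add, add_assoc]
    refine le_add_of_nonneg_right ?_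
    have := neg_abs_le_self hD
    rwa [neg_le_iff_add_nonneg'] at this
  have hqE : 0 ≤ q * opTrace (CFC.abs D) := mul_nonneg hq.1.le hEn
  have a1 := (abs_le.1 (hw.homExt_add hconv hf hPf huf hq (by rw [htrs]; nlinarith)).2).1
  have a2 := (abs_le.1 (hw.homExt_add hconv hf hEf hAf hq (by nlinarith)).2).2
  rw [hsum, htrs] at a1
  have a3 := hPf.homExt_nonneg hf
  have a4 : (opTrace (CFC.abs D) + opTrace A) * w q ≤ η / 4 := by
    calc (opTrace (CFC.abs D) + opTrace A) * w q ≤ T * (η / (4 * T)) :=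
          mul_le_mul (by simp only [T]; linarith) hqw.le (hw.nonneg q hq) hT.le
      _ = η / 4 := by field_simp
  linarith

end FiniteRankContinuity

/-! ### Compatible splittings of the two sequences -/

section Splitting

set_option linter.unusedSectionVars false

variable {H : Type*} [NormedAddCommGroup H] [InnerProductSpace ℂ H] [CompleteSpace H]
  {f : (H →L[ℂ] H) → EReal} {S : Set (H →L[ℂ] H)} {w : ℝ → ℝ}

/-- Compatible splittings of `ρ n` and `τ n`, where `c • ρ n ≤ τ n`, into parts `A n`, `B n` of
bounded rank and remainders of trace less than `η`. -/
structure IsSplitting (ρ τ : ℕ → H →L[ℂ] H) (c η : ℝ) (A B : ℕ → H →L[ℂ] H) (m : ℕ) :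
    Prop where
  nonneg_left : ∀ n, 0 ≤ A n
  le_left : ∀ n, A n ≤ ρ n
  rank_left : ∀ n, RankAtMost (A n) m
  rank_right : ∀ n, RankAtMost (B n) m
  tendsto_left : TraceTendsto A (A 0)
  tendsto_right : TraceTendsto B (B 0)
  smul_le : ∀ n, c • A n ≤ B n
  smul_sub_le : ∀ n, c • (ρ n - A n) ≤ τ n - B n
  trace_left : ∀ n, posTrace (ρ n - A n) < ENNReal.ofReal η
  trace_right : ∀ n, posTrace (τ n - B n) < ENNReal.ofReal η

theorem le_one_of_smul_le {ρ τ : H →L[ℂ] H} (hρ : ρ ∈ quantumStates H) (hτ : τ ∈ quantumStates H)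
    {c : ℝ} (hc : 0 < c) (h : c • ρ ≤ τ) : c ≤ 1 := by
  have := posTrace_mono h
  rw [posTrace_smul hc.le, hρ.2, hτ.2, mul_one] at this
  exact ENNReal.ofReal_le_one.1 this

theorem exists_isSplitting {ρ τ : ℕ → H →L[ℂ] H} (hρ : ∀ n, ρ n ∈ quantumStates H)
    (hτ : ∀ n, τ n ∈ quantumStates H) (hρlim : TraceTendsto ρ (ρ 0))
    (hτlim : TraceTendsto τ (τ 0)) {c : ℝ} (hc : 0 < c) (hdom : ∀ n, c • ρ n ≤ τ n) {η : ℝ}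
    (hη : 0 < η) : ∃ A B m, IsSplitting ρ τ c η A B m := by
  have hc1 := le_one_of_smul_le (hρ 0) (hτ 0) hc (hdom 0)
  have hη2 : 0 < ENNReal.ofReal (η / 2) := ENNReal.ofReal_pos.2 (half_pos hη)
  -- Truncating τ directly need not preserve domination. Truncating ρ to A and κ to K, with B = cA +
  -- K, keeps it for both the main parts and the remainders.
  set κ : ℕ → H →L[ℂ] H := fun n => τ n - c • ρ n with hκdef
  have hκ : ∀ n, 0 ≤ κ n := fun n => sub_nonneg.2 (hdom n)
  have hκtr : ∀ n, posTrace (κ n) ≤ 1 := fun n =>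
    (posTrace_mono (sub_le_self (τ n) (smul_nonneg hc.le (hρ n).1))).trans (hτ n).2.le
  have hκlim : TraceTendsto κ (κ 0) := by
    have := hτlim.add (hρlim.const_smul (-c)) (fun n => .of_nonneg (hτ n).1)
      (fun n => .smul (.all _) (.of_nonneg (hρ n).1)) (.of_nonneg (hτ 0).1)
      (.smul (.all _) (.of_nonneg (hρ 0).1))
    simpa only [neg_smul, ← sub_eq_add_neg] using this
  obtain ⟨A, a, hA0, hAle, hAr, hAlim, hAtr⟩ :=
    exists_finiteRank_approx (fun n => (hρ n).1) (fun n => (hρ n).2.le) hρlim hη2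
  obtain ⟨K, k, hK0, hKle, hKr, hKlim, hKtr⟩ := exists_finiteRank_approx hκ hκtr hκlim hη2
  have hrest : ∀ n, τ n - (c • A n + K n) = c • (ρ n - A n) + (κ n - K n) := by
    intro n
    simp only [hκdef, smul_sub]
    abel
  refine ⟨A, fun n => c • A n + K n, a + k, hA0, hAle, fun n => (hAr n).mono (by lia),
    fun n => ((hAr n).smul c).add (hKr n), hAlim, ?_, fun n => le_add_of_nonneg_right (hK0 n),
    fun n => ?_, fun n => (hAtr n).trans_le (ENNReal.ofReal_le_ofReal (by linarith)),
    fun n => ?_⟩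
  · exact (hAlim.const_smul c).add hKlim (fun n => .smul (.all _) (.of_nonneg (hA0 n)))
      (fun n => .of_nonneg (hK0 n)) (.smul (.all _) (.of_nonneg (hA0 0))) (.of_nonneg (hK0 0))
  · rw [hrest]
    exact le_add_of_nonneg_right (sub_nonneg.2 (hKle n))
  · rw [hrest, posTrace_add (smul_nonneg hc.le (sub_nonneg.2 (hAle n)))
      (sub_nonneg.2 (hKle n)), posTrace_smul hc.le]
    calc ENNReal.ofReal c * posTrace (ρ n - A n) + posTrace (κ n - K n)
        < ENNReal.ofReal (η / 2) + ENNReal.ofReal (η / 2) := by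
          refine ENNReal.add_lt_add ?_ (hKtr n)
          refine lt_of_le_of_lt ?_ (hAtr n)
          exact mul_le_of_le_one_left' (ENNReal.ofReal_le_one.2 hc1)
      _ = ENNReal.ofReal η := by
          rw [← ENNReal.ofReal_add (half_pos hη).le (half_pos hη).le, add_halves]

end Splitting

/-! ### From eventual inequalities to limits -/

section ErealLimits

theorem limsup_sub_le_mul {x y : ℕ → ℝ} {c : ℝ} (hc : 0 < c) (hy : ∀ n, 0 ≤ y n)
    (h : ∀ ε > 0, ∀ᶠ n in atTop, c * (x n - x 0) ≤ y n - y 0 + ε) :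
    limsup (fun n => (x n : EReal)) atTop - (x 0 : EReal) ≤
      ((1 / c : ℝ) : EReal) * (limsup (fun n => (y n : EReal)) atTop - (y 0 : EReal)) := by
  have hL0 : (0 : EReal) ≤ limsup (fun n => (y n : EReal)) atTop :=
    le_limsup_of_frequently_le (Frequently.of_forall fun n => by exact_mod_cast hy n)
  rcases eq_or_ne (limsup (fun n => (y n : EReal)) atTop) ⊤ with ht | ht
  · rw [ht, EReal.top_sub_coe, EReal.mul_top_of_pos (by exact_mod_cast one_div_pos.2 hc)]
    exact le_top
  have hev : ∀ z : EReal, limsup (fun n => (y n : EReal)) atTop < z →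
      ∀ᶠ n in atTop, (y n : EReal) < z := fun z hz => eventually_lt_of_limsup_lt hz
  generalize limsup (fun n => (y n : EReal)) atTop = L at hL0 ht hev
  lift L to ℝ using ⟨ht, (EReal.bot_lt_zero.trans_le hL0).ne'⟩
  rw [EReal.sub_le_iff_le_add (Or.inl (EReal.coe_ne_bot _)) (Or.inl (EReal.coe_ne_top _))]
  norm_cast
  rw [← EReal.le_of_forall_lt_iff_le]
  intro z hz
  have hz' : 1 / c * (L - y 0) + x 0 < z := by exact_mod_cast hz
  -- Half of c times the available gap: one ε for the hypothesis, one for replacing y by its limsup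
  -- L.
  set ε := c * (z - (1 / c * (L - y 0) + x 0)) / 2 with hε
  have hε0 : 0 < ε := half_pos (mul_pos hc (sub_pos.2 hz'))
  refine limsup_le_of_le (h := ?_)
  filter_upwards [h ε hε0, hev ((L + ε : ℝ) : EReal) (by exact_mod_cast lt_add_of_pos_right L hε0)]
    with n h1 h2
  have h3 : y n < L + ε := by exact_mod_cast h2
  have h4 : c * (x n - x 0) ≤ c * (z - x 0) := by
    have : 2 * ε = c * (z - x 0) - (L - y 0) := by rw [hε]; field_simp; ring
    linarith
  have h5 := le_of_mul_le_mul_left h4 hc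
  exact_mod_cast (by linarith : x n ≤ z)

theorem tendsto_of_eventually_mul_sub_le {x y : ℕ → ℝ} {c : ℝ} (hc : 0 < c)
    (h : ∀ ε > 0, ∀ᶠ n in atTop, c * (x n - x 0) ≤ y n - y 0 + ε)
    (hx : ∀ ε > 0, ∀ᶠ n in atTop, x 0 - ε ≤ x n) (hy : Tendsto y atTop (𝓝 (y 0))) :
    Tendsto x atTop (𝓝 (x 0)) := by
  rw [Metric.tendsto_nhds]
  intro ε hε
  have hε' : 0 < c * ε / 4 := by positivity
  filter_upwards [h _ hε', hx _ (half_pos hε), hy.eventually (gt_mem_nhds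
    (lt_add_of_pos_right (y 0) hε'))] with n h1 h2 h3
  rw [Real.dist_eq, abs_lt]
  refine ⟨by linarith, ?_⟩
  have : c * (x n - x 0) < c * ε := by nlinarith
  exact lt_of_mul_lt_mul_left this hc.le

end ErealLimits

/-! ### Comparing jumps through a splitting -/

section Estimates

set_option linter.unusedSectionVars false

variable {H : Type*} [NormedAddCommGroup H] [InnerProductSpace ℂ H] [CompleteSpace H]
  {f : (H →L[ℂ] H) → EReal} {S : Set (H →L[ℂ] H)} {w : ℝ → ℝ}

theorem opTrace_le_of_lt {A : H →L[ℂ] H} {η : ℝ} (hη : 0 < η)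
    (h : posTrace A < ENNReal.ofReal η) : opTrace A ≤ η := by
  have := ENNReal.toReal_mono ENNReal.ofReal_ne_top h.le
  rwa [ENNReal.toReal_ofReal hη.le] at this

theorem IsAffinityModulus.homExt_split (hw : IsAffinityModulus f S w) (hconv : Convex ℝ S)
    (hf : ∀ ω ∈ S, 0 ≤ f ω) {ω A : H →L[ℂ] H} (hω : ω ∈ quantumStates H) (hA : IsFiniteAt f S A)
    (hR : IsFiniteAt f S (ω - A)) {η : ℝ} (hη : η ∈ Ioc (0 : ℝ) (1 / 2))
    (htr : opTrace (ω - A) ≤ η) : |homExt f ω - (homExt f A + homExt f (ω - A))| ≤ w η := by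
  have h1 : opTrace (ω - A) + opTrace A = 1 := by
    rw [← opTrace_add hR.nonneg hA.nonneg hR.trace_ne_top hA.trace_ne_top, sub_add_cancel,
      opTrace_of_mem hω]
  have h2 := (hw.homExt_add hconv hf hR hA hη (by rw [h1, mul_one]; exact htr)).2
  rwa [h1, one_mul, sub_add_cancel, add_comm (homExt f (ω - A))] at h2

theorem IsSplitting.le_right {ρ τ A B : ℕ → H →L[ℂ] H} {c η : ℝ} {m : ℕ}
    (h : IsSplitting ρ τ c η A B m) (hc : 0 < c) (n : ℕ) : B n ≤ τ n :=
  sub_nonneg.1 ((smul_nonneg hc.le (sub_nonneg.2 (h.le_left n))).trans (h.smul_sub_le n))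

theorem IsSplitting.nonneg_right {ρ τ A B : ℕ → H →L[ℂ] H} {c η : ℝ} {m : ℕ}
    (h : IsSplitting ρ τ c η A B m) (hc : 0 < c) (n : ℕ) : 0 ≤ B n :=
  (smul_nonneg hc.le (h.nonneg_left n)).trans (h.smul_le n)

theorem TraceTendsto.sub {u v : ℕ → H →L[ℂ] H} {A B : H →L[ℂ] H} (hu : TraceTendsto u A)
    (hv : TraceTendsto v B) (hus : ∀ n, IsSelfAdjoint (u n)) (hvs : ∀ n, IsSelfAdjoint (v n))
    (hA : IsSelfAdjoint A) (hB : IsSelfAdjoint B) :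
    TraceTendsto (fun n => u n - v n) (A - B) := by
  have := hu.add (hv.const_smul (-1)) hus (fun n => .smul (.all _) (hvs n)) hA (.smul (.all _) hB)
  simpa only [neg_one_smul, ← sub_eq_add_neg] using this

variable {ρ τ A B : ℕ → H →L[ℂ] H} {c η : ℝ} {m : ℕ}

theorem IsSplitting.isFiniteAt (h : IsSplitting ρ τ c η A B m) (hc : 0 < c)
    (hdom : ∀ n, c • ρ n ≤ τ n)
    (hfb : ∀ n (X : H →L[ℂ] H) (t : ℝ), 0 ≤ X → X ≤ t • τ n → IsFiniteAt f S X) (n : ℕ) :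
    (IsFiniteAt f S (A n) ∧ IsFiniteAt f S (ρ n - A n)) ∧
      (IsFiniteAt f S (B n) ∧ IsFiniteAt f S (τ n - B n)) ∧
      IsFiniteAt f S (τ n - B n - c • (ρ n - A n)) := by
  have hρτ : ρ n ≤ c⁻¹ • τ n := by
    have := smul_le_smul_of_nonneg_left (hdom n) (inv_nonneg.2 hc.le)
    rwa [smul_smul, inv_mul_cancel₀ hc.ne', one_smul] at this
  have hone : ∀ {X : H →L[ℂ] H}, 0 ≤ X → X ≤ τ n → IsFiniteAt f S X := fun h1 h2 =>
    hfb n _ 1 h1 (by rwa [one_smul])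
  have hB := h.nonneg_right hc n
  have hR := sub_nonneg.2 (h.le_left n)
  have hτB : τ n - B n ≤ τ n := sub_le_self _ hB
  refine ⟨⟨hfb n _ _ (h.nonneg_left n) ((h.le_left n).trans hρτ), hfb n _ _ hR
    ((sub_le_self _ (h.nonneg_left n)).trans hρτ)⟩, ⟨hone hB (h.le_right hc n),
    hone (sub_nonneg.2 (h.le_right hc n)) hτB⟩, hone (sub_nonneg.2 (h.smul_sub_le n))
    ((sub_le_self _ (smul_nonneg hc.le hR)).trans hτB)⟩

/-- Eliminate F(R) between F(ρ) ≈ F(A) + F(R) and F(τ) ≈ F(B) + cF(R) + F(K), at n and at 0. The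
four splittings of ρ and τ cost at most w(η) each (using c ≤ 1), the two of τ − B cost ηw(1/2) each,
and A, B, K contribute one δ each. -/
theorem IsSplitting.eventually_mul_sub_le (h : IsSplitting ρ τ c η A B m)
    (hw : IsAffinityModulus f S w) (hconv : Convex ℝ S) (hf : ∀ ω ∈ S, 0 ≤ f ω)
    (hlsc : TraceLowerSemicontinuousOn f S) (hc : 0 < c) (hc1 : c ≤ 1)
    (hρ : ∀ n, ρ n ∈ quantumStates H) (hτ : ∀ n, τ n ∈ quantumStates H)
    (hρlim : TraceTendsto ρ (ρ 0)) (hτlim : TraceTendsto τ (τ 0)) (hdom : ∀ n, c • ρ n ≤ τ n)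
    (hfb : ∀ n (X : H →L[ℂ] H) (t : ℝ), 0 ≤ X → X ≤ t • τ n → IsFiniteAt f S X)
    (hη : η ∈ Ioc (0 : ℝ) (1 / 2)) {δ : ℝ} (hδ : 0 < δ)
    (hA : ∀ᶠ n in atTop, homExt f (A n) ≤ homExt f (A 0) + δ) :
    ∀ᶠ n in atTop, c * (homExt f (ρ n) - homExt f (ρ 0)) ≤ homExt f (τ n) - homExt f (τ 0) +
      (4 * w η + 2 * (η * w (1 / 2)) + 3 * δ) := by
  set K : ℕ → H →L[ℂ] H := fun n => τ n - B n - c • (ρ n - A n)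
  have hB0 := h.nonneg_right hc
  have hfin := h.isFiniteAt hc hdom hfb
  have hKlim : TraceTendsto K (K 0) := by
    refine (hτlim.sub h.tendsto_right (fun n => .of_nonneg (hτ n).1) (fun n => .of_nonneg (hB0 n))
      (.of_nonneg (hτ 0).1) (.of_nonneg (hB0 0))).sub ((hρlim.sub h.tendsto_left
        (fun n => .of_nonneg (hρ n).1) (fun n => .of_nonneg (h.nonneg_left n))
        (.of_nonneg (hρ 0).1) (.of_nonneg (h.nonneg_left 0))).const_smul c) ?_ ?_ ?_ ?_
    · exact fun n => isSelfAdjoint_of_sub (hτ n).1 (hB0 n)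
    · exact fun n => .smul (.all _) (isSelfAdjoint_of_sub (hρ n).1 (h.nonneg_left n))
    · exact isSelfAdjoint_of_sub (hτ 0).1 (hB0 0)
    · exact .smul (.all _) (isSelfAdjoint_of_sub (hρ 0).1 (h.nonneg_left 0))
  have hw2 : 0 ≤ w (1 / 2) := hw.nonneg _ (by norm_num)
  have hwη : 0 ≤ w η := hw.nonneg _ hη
  have key : ∀ n, |homExt f (ρ n) - (homExt f (A n) + homExt f (ρ n - A n))| ≤ w η ∧
      |homExt f (τ n) - (homExt f (B n) + homExt f (τ n - B n))| ≤ w η ∧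
      |homExt f (τ n - B n) - (c * homExt f (ρ n - A n) + homExt f (K n))| ≤ η * w (1 / 2) := by
    intro n
    obtain ⟨⟨h1, h2⟩, ⟨h3, h4⟩, h5⟩ := hfin n
    refine ⟨hw.homExt_split hconv hf (hρ n) h1 h2 hη (opTrace_le_of_lt hη.1 (h.trace_left n)),
      hw.homExt_split hconv hf (hτ n) h3 h4 hη (opTrace_le_of_lt hη.1 (h.trace_right n)), ?_⟩
    have h6 := h2.smul hc.le
    -- The relative sizes of cR and K are unknown, so only w(1/2) is available; the factor Tr(τ − B)
    -- ≤ η makes the error small.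
    have h7 := (hw.homExt_add_half hconv hf h6 h5).2
    rw [← opTrace_add h6.nonneg h5.nonneg h6.trace_ne_top h5.trace_ne_top, add_sub_cancel,
      homExt_smul f hc.le] at h7
    exact h7.trans (mul_le_mul_of_nonneg_right (opTrace_le_of_lt hη.1 (h.trace_right n)) hw2)
  filter_upwards [hA, hlsc.eventually_homExt hf h.tendsto_right (fun n => (hfin n).2.1.1)
    (hfin 0).2.1.1 hδ, hlsc.eventually_homExt hf hKlim (fun n => (hfin n).2.2) (hfin 0).2.2 hδ]
    with n e1 e2 e3
  obtain ⟨a1, a2, a3⟩ := key n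
  obtain ⟨b1, b2, b3⟩ := key 0
  rw [abs_le] at a1 a2 a3 b1 b2 b3
  have p1 := mul_le_mul_of_nonneg_left a1.2 hc.le
  have p2 := mul_le_mul_of_nonneg_left b1.1 hc.le
  have p3 := mul_le_mul_of_nonneg_left e1 hc.le
  have p4 : c * w η ≤ w η := mul_le_of_le_one_left hwη hc1
  have p5 : c * δ ≤ δ := mul_le_of_le_one_left hδ.le hc1
  linarith [a2.1, a2.2, a3.1, a3.2, b2.1, b2.2, b3.1, b3.2]

/-- F(B) ≈ F(τ) − F(τ − B), and the subtracted term is lower semicontinuous along the sequence. -/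
theorem IsSplitting.eventually_right_le (h : IsSplitting ρ τ c η A B m)
    (hw : IsAffinityModulus f S w) (hconv : Convex ℝ S) (hf : ∀ ω ∈ S, 0 ≤ f ω)
    (hlsc : TraceLowerSemicontinuousOn f S) (hc : 0 < c)
    (hτ : ∀ n, τ n ∈ quantumStates H)
    (hτlim : TraceTendsto τ (τ 0)) (hdom : ∀ n, c • ρ n ≤ τ n)
    (hfb : ∀ n (X : H →L[ℂ] H) (t : ℝ), 0 ≤ X → X ≤ t • τ n → IsFiniteAt f S X)
    (hη : η ∈ Ioc (0 : ℝ) (1 / 2)) {δ : ℝ} (hδ : 0 < δ)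
    (hτf : ∀ᶠ n in atTop, homExt f (τ n) ≤ homExt f (τ 0) + δ) :
    ∀ᶠ n in atTop, homExt f (B n) ≤ homExt f (B 0) + (2 * δ + 2 * w η) := by
  have hB0 := h.nonneg_right hc
  have hfin := h.isFiniteAt hc hdom hfb
  have hlim : TraceTendsto (fun n => τ n - B n) (τ 0 - B 0) :=
    hτlim.sub h.tendsto_right (fun n => .of_nonneg (hτ n).1) (fun n => .of_nonneg (hB0 n))
      (.of_nonneg (hτ 0).1) (.of_nonneg (hB0 0))
  have key : ∀ n, |homExt f (τ n) - (homExt f (B n) + homExt f (τ n - B n))| ≤ w η := fun n =>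
    hw.homExt_split hconv hf (hτ n) (hfin n).2.1.1 (hfin n).2.1.2 hη
      (opTrace_le_of_lt hη.1 (h.trace_right n))
  filter_upwards [hτf, hlsc.eventually_homExt hf hlim (fun n => (hfin n).2.1.2) (hfin 0).2.1.2 hδ]
    with n e1 e2
  have a := abs_le.1 (key n)
  have b := abs_le.1 (key 0)
  linarith [a.1, b.2]

theorem eventually_toReal_normalizedState_le {u : ℕ → H →L[ℂ] H} (hu : TraceTendsto u (u 0))
    (hfu : ∀ n, IsFiniteAt f S (u n)) (h0 : posTrace (u 0) ≠ 0) {β δ : ℝ} (hδ : 0 < δ)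
    (h : ∀ᶠ n in atTop, homExt f (u n) ≤ homExt f (u 0) + β) :
    ∀ᶠ n in atTop, (f (normalizedState (u n))).toReal ≤
      (f (normalizedState (u 0))).toReal + β / opTrace (u 0) + δ := by
  have ht := opTrace_pos (hfu 0).trace_ne_top h0
  have htr := hu.tendsto_opTrace (fun n => (hfu n).nonneg) (hfu 0).nonneg (hfu 0).trace_ne_top
  have hlim : Tendsto (fun n => (homExt f (u 0) + β) / opTrace (u n)) atTop
      (𝓝 ((homExt f (u 0) + β) / opTrace (u 0))) := tendsto_const_nhds.div htr ht.ne'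
  have e : (homExt f (u 0) + β) / opTrace (u 0) =
      (f (normalizedState (u 0))).toReal + β / opTrace (u 0) := by
    rw [homExt]; field_simp
  rw [e] at hlim
  filter_upwards [h, htr.eventually (lt_mem_nhds ht),
    hlim.eventually (gt_mem_nhds (lt_add_of_pos_right _ hδ))] with n h1 h2 h3
  refine le_trans ?_ h3.le
  rwa [le_div_iff₀ h2, mul_comm]

theorem eventually_homExt_le_of_toReal {u : ℕ → H →L[ℂ] H} (hu : TraceTendsto u (u 0))
    (hfu : ∀ n, IsFiniteAt f S (u n)) (hle : opTrace (u 0) ≤ 1) {ε δ : ℝ} (hε : 0 ≤ ε)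
    (hδ : 0 < δ)
    (h : ∀ᶠ n in atTop, (f (normalizedState (u n))).toReal ≤
      (f (normalizedState (u 0))).toReal + ε) :
    ∀ᶠ n in atTop, homExt f (u n) ≤ homExt f (u 0) + (ε + δ) := by
  have htr := hu.tendsto_opTrace (fun n => (hfu n).nonneg) (hfu 0).nonneg (hfu 0).trace_ne_top
  have hlim := htr.mul_const ((f (normalizedState (u 0))).toReal + ε)
  filter_upwards [h, hlim.eventually (gt_mem_nhds (lt_add_of_pos_right _ hδ))] with n h1 h2
  have h3 := mul_le_mul_of_nonneg_left h1 (opTrace_nonneg (u n))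
  have h4 : opTrace (u 0) * ε ≤ ε := mul_le_of_le_one_left hε hle
  rw [homExt, homExt]
  linarith

end Estimates

/-! ### Reduction to the bounded-rank parts, and the case of a jump bound G -/

section Main

set_option linter.unusedSectionVars false

variable {H : Type*} [NormedAddCommGroup H] [InnerProductSpace ℂ H] [CompleteSpace H]
  {f : (H →L[ℂ] H) → EReal} {S : Set (H →L[ℂ] H)} {w : ℝ → ℝ}

theorem IsAffinityModulus.eventually_small (hw : IsAffinityModulus f S w) {ε : ℝ} (hε : 0 < ε) :
    ∀ᶠ η in 𝓝[>] 0, 4 * w η + 2 * (η * w (1 / 2)) < ε := by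
  have h1 : Tendsto (fun η : ℝ => 2 * (η * w (1 / 2))) (𝓝[>] 0) (𝓝 0) := by
    have : Continuous fun η : ℝ => 2 * (η * w (1 / 2)) := by fun_prop
    simpa using (this.tendsto 0).mono_left nhdsWithin_le_nhds
  have h2 := (hw.tendsto.const_mul 4).add h1
  rw [mul_zero, add_zero] at h2
  exact h2.eventually (gt_mem_nhds hε)

variable {ρ τ : ℕ → H →L[ℂ] H} {c : ℝ}

theorem eventually_mul_sub_le_of_splitting (hw : IsAffinityModulus f S w) (hconv : Convex ℝ S)
    (hf : ∀ ω ∈ S, 0 ≤ f ω) (hlsc : TraceLowerSemicontinuousOn f S) (hc : 0 < c)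
    (hρ : ∀ n, ρ n ∈ quantumStates H) (hτ : ∀ n, τ n ∈ quantumStates H)
    (hρlim : TraceTendsto ρ (ρ 0)) (hτlim : TraceTendsto τ (τ 0)) (hdom : ∀ n, c • ρ n ≤ τ n)
    (hfb : ∀ n (X : H →L[ℂ] H) (t : ℝ), 0 ≤ X → X ≤ t • τ n → IsFiniteAt f S X)
    (hA : ∀ ε > 0, ∀ᶠ η in 𝓝[>] (0 : ℝ), ∀ A B m, IsSplitting ρ τ c η A B m →
      ∀ᶠ n in atTop, homExt f (A n) ≤ homExt f (A 0) + ε) :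
    ∀ ε > 0, ∀ᶠ n in atTop, c * ((f (ρ n)).toReal - (f (ρ 0)).toReal) ≤
      (f (τ n)).toReal - (f (τ 0)).toReal + ε := by
  intro ε hε
  -- Three δ make ε/2; the terms in w take the other half.
  have hδ : 0 < ε / 6 := by positivity
  obtain ⟨η, ⟨h1, h2⟩, hη⟩ := (((hA _ hδ).and (hw.eventually_small (half_pos hε))).and
    (Ioc_mem_nhdsGT (by norm_num : (0 : ℝ) < 1 / 2))).exists
  obtain ⟨A, B, m, hsp⟩ := exists_isSplitting hρ hτ hρlim hτlim hc hdom hη.1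
  filter_upwards [hsp.eventually_mul_sub_le hw hconv hf hlsc hc
    (le_one_of_smul_le (hρ 0) (hτ 0) hc (hdom 0)) hρ hτ hρlim hτlim hdom hfb hη hδ
    (h1 A B m hsp)] with n hn
  rw [homExt_of_mem f (hρ n), homExt_of_mem f (hρ 0), homExt_of_mem f (hτ n),
    homExt_of_mem f (hτ 0)] at hn
  linarith

theorem half_le_opTrace_of_lt {ω A : H →L[ℂ] H} (hω : ω ∈ quantumStates H) (hA : 0 ≤ A)
    (hle : A ≤ ω) {η : ℝ} (hη : η ∈ Ioc (0 : ℝ) (1 / 2))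
    (h : posTrace (ω - A) < ENNReal.ofReal η) :
    1 / 2 ≤ opTrace A ∧ opTrace A ≤ 1 ∧ posTrace A ≠ 0 ∧ posTrace A ≠ ⊤ := by
  have hAt : posTrace A ≠ ⊤ :=
    ne_top_of_le_ne_top (by rw [hω.2]; exact ENNReal.one_ne_top) (posTrace_mono hle)
  have h1 := opTrace_add (sub_nonneg.2 hle) hA (h.trans ENNReal.ofReal_lt_top).ne hAt
  rw [sub_add_cancel, opTrace_of_mem hω] at h1
  have h2 := opTrace_le_of_lt hη.1 h
  have h3 := opTrace_nonneg (ω - A)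
  have h4 : 1 / 2 ≤ opTrace A := by linarith [hη.2]
  refine ⟨h4, by linarith, fun h0 => ?_, hAt⟩
  rw [opTrace, h0] at h4
  norm_num at h4

/-- For η ≤ 1/2 the traces of A and B lie in [1/2, 1], so normalizing multiplies them by a factor in
[1, 2]. This is where the constants 2 and 4 in the domination conditions come from. -/
theorem eventually_homExt_left_le_of_jump (hw : IsAffinityModulus f S w) (hconv : Convex ℝ S)
    (hf : ∀ ω ∈ S, 0 ≤ f ω) (hlsc : TraceLowerSemicontinuousOn f S) (hc : 0 < c)
    (hρ : ∀ n, ρ n ∈ quantumStates H) (hτ : ∀ n, τ n ∈ quantumStates H)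
    (hτlim : TraceTendsto τ (τ 0)) (hdom : ∀ n, c • ρ n ≤ τ n)
    (hfb : ∀ n (X : H →L[ℂ] H) (t : ℝ), 0 ≤ X → X ≤ t • τ n → IsFiniteAt f S X)
    (hτf : ∀ δ > 0, ∀ᶠ n in atTop, homExt f (τ n) ≤ homExt f (τ 0) + δ)
    {G : ℝ → ℝ} (hG0 : G 0 = 0) (hG : Tendsto G (𝓝[>] 0) (𝓝 0))
    (hjump : ∀ ρ' τ' : ℕ → H →L[ℂ] H,
          (∀ n, ρ' n ∈ quantumStates H) → (∀ n, τ' n ∈ quantumStates H) →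
          TraceTendsto ρ' (ρ' 0) → TraceTendsto τ' (τ' 0) →
          (∀ n, ρ' n ≤ (2 : ℝ) • ρ n) →
          (∀ n, c • ρ' n ≤ (2 : ℝ) • τ' n) → (∀ n, (2 : ℝ) • τ' n ≤ (4 : ℝ) • τ n) →
          (∃ m : ℕ, ∀ n, RankAtMost (τ' n) m) →
          discontinuityJump f ρ' ≤ (G (discontinuityJump f τ').toReal : EReal)) :
    ∀ ε > 0, ∀ᶠ η in 𝓝[>] (0 : ℝ), ∀ A B m, IsSplitting ρ τ c η A B m →
      ∀ᶠ n in atTop, homExt f (A n) ≤ homExt f (A 0) + ε := by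
  intro ε hε
  -- The one-sided limit says nothing at 0, where the value of G is used instead; a zero jump does
  -- occur.
  obtain ⟨r, hr, hGr⟩ : ∃ r > 0, ∀ x, 0 ≤ x → x < r → G x < ε / 4 := by
    obtain ⟨r, hr, hsub⟩ := mem_nhdsGT_iff_exists_Ioo_subset.1
      (hG.eventually (gt_mem_nhds (show (0 : ℝ) < ε / 4 by positivity)))
    refine ⟨r, hr, fun x hx0 hx => ?_⟩
    rcases hx0.eq_or_lt with rfl | hx0
    · rw [hG0]; positivity
    · exact hsub ⟨hx0, hx⟩
  have hδ : 0 < r / 12 := div_pos hr (by norm_num)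
  filter_upwards [hw.tendsto.eventually (gt_mem_nhds (show (0 : ℝ) < r / 12 from hδ)),
    Ioc_mem_nhdsGT (by norm_num : (0 : ℝ) < 1 / 2)] with η hwη hη A B m hsp
  have hB0 := hsp.nonneg_right hc
  have hBle := hsp.le_right hc
  have hfin := hsp.isFiniteAt hc hdom hfb
  have hAt := fun n => half_le_opTrace_of_lt (hρ n) (hsp.nonneg_left n) (hsp.le_left n) hη
    (hsp.trace_left n)
  have hBt := fun n => half_le_opTrace_of_lt (hτ n) (hB0 n) (hBle n) hη (hsp.trace_right n)
  have hbot : ∀ ω ∈ S, f ω ≠ ⊥ := fun ω hω => (EReal.bot_lt_zero.trans_le (hf ω hω)).ne'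
  have hinv : ∀ {x : ℝ}, 1 / 2 ≤ x → x⁻¹ ≤ 2 := fun hx => by
    rw [inv_le_comm₀ (by linarith) (by norm_num)]; linarith
  have hAlim := hsp.tendsto_left.normalizedState hsp.nonneg_left (hsp.nonneg_left 0)
    (hAt 0).2.2.2 (hAt 0).2.2.1
  have hBlim := hsp.tendsto_right.normalizedState hB0 (hB0 0) (hBt 0).2.2.2 (hBt 0).2.2.1
  have hAle : ∀ n, normalizedState (A n) ≤ (2 : ℝ) • A n := fun n =>
    smul_le_smul_of_nonneg_right (hinv (hAt n).1) (hsp.nonneg_left n)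
  have hBle2 : ∀ n, normalizedState (B n) ≤ (2 : ℝ) • B n := fun n =>
    smul_le_smul_of_nonneg_right (hinv (hBt n).1) (hB0 n)
  have hBge : ∀ n, B n ≤ normalizedState (B n) := fun n => by
    have h1 : 1 ≤ (opTrace (B n))⁻¹ :=
      (one_le_inv₀ (by linarith [(hBt n).1])).2 (hBt n).2.1
    have := smul_le_smul_of_nonneg_right h1 (hB0 n)
    rwa [one_smul] at this
  have hJ := hjump (fun n => normalizedState (A n)) (fun n => normalizedState (B n))
    (fun n => normalizedState_mem (hsp.nonneg_left n) (hAt n).2.2.2 (hAt n).2.2.1)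
    (fun n => normalizedState_mem (hB0 n) (hBt n).2.2.2 (hBt n).2.2.1) hAlim hBlim
    (fun n => (hAle n).trans (smul_le_smul_of_nonneg_left (hsp.le_left n) (by norm_num)))
    (fun n => by
      calc c • normalizedState (A n) ≤ c • (2 : ℝ) • A n :=
            smul_le_smul_of_nonneg_left (hAle n) hc.le
        _ = (2 : ℝ) • c • A n := smul_comm _ _ _
        _ ≤ (2 : ℝ) • normalizedState (B n) :=
            smul_le_smul_of_nonneg_left ((hsp.smul_le n).trans (hBge n)) (by norm_num))
    (fun n => by
      calc (2 : ℝ) • normalizedState (B n) ≤ (2 : ℝ) • (2 : ℝ) • τ n :=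
            smul_le_smul_of_nonneg_left ((hBle2 n).trans
              (smul_le_smul_of_nonneg_left (hBle n) (by norm_num))) (by norm_num)
        _ = (4 : ℝ) • τ n := by rw [smul_smul]; norm_num)
    ⟨m, fun n => (hsp.rank_right n).smul _⟩
  have hmemA := fun n => (hfin n).1.1.mem (hAt n).2.2.1
  have hmemB := fun n => (hfin n).2.1.1.mem (hBt n).2.2.1
  have hreal : ∀ ω ∈ S, f ω ≠ ⊤ → ((f ω).toReal : EReal) = f ω := fun ω hω ht =>
    EReal.coe_toReal ht (hbot ω hω)
  have hxA := fun n => hreal _ (hmemA n) ((hfin n).1.1.finite (hAt n).2.2.1)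
  have hxB := fun n => hreal _ (hmemB n) ((hfin n).2.1.1.finite (hBt n).2.2.1)
  have hBev := eventually_toReal_normalizedState_le hsp.tendsto_right (fun n => (hfin n).2.1.1)
    (hBt 0).2.2.1 hδ (hsp.eventually_right_le hw hconv hf hlsc hc hτ hτlim hdom hfb hη hδ
      (hτf _ hδ))
  set y : ℕ → ℝ := fun n => (f (normalizedState (B n))).toReal
  set x : ℕ → ℝ := fun n => (f (normalizedState (A n))).toReal
  set β := (2 * (r / 12) + 2 * w η) / opTrace (B 0) + r / 12
  -- With δ and w(η) at most r/12 and 1/Tr B₀ ≤ 2, β is at most 9r/12.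
  have hβ : β < r := by
    have h1 : (2 * (r / 12) + 2 * w η) / opTrace (B 0) ≤ (2 * (r / 12) + 2 * w η) * 2 := by
      rw [div_eq_mul_inv]
      exact mul_le_mul_of_nonneg_left (hinv (hBt 0).1)
        (by linarith [hw.nonneg η hη])
    simp only [β]
    linarith
  have hup : limsup (fun n => f (normalizedState (B n))) atTop ≤ ((y 0 + β : ℝ) : EReal) := by
    refine limsup_le_of_le (h := ?_)
    filter_upwards [hBev] with n hn
    rw [← hxB n]
    exact_mod_cast hn.trans (by simp only [β, y]; linarith)
  -- Lower semicontinuity makes the jump nonnegative; with the upper bound it is finite, so `toReal`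
  -- in the argument of G loses nothing.
  have hlow : ((y 0 : ℝ) : EReal) ≤ limsup (fun n => f (normalizedState (B n))) atTop := by
    refine le_of_forall_lt fun z hz => ?_
    obtain ⟨z', hz1, hz2⟩ := exists_between hz
    refine hz1.trans_le (le_limsup_of_frequently_le ?_)
    have := hlsc.eventually_lt hBlim (Eventually.of_forall hmemB) (hmemB 0) (by rwa [← hxB 0])
    exact (this.mono fun n h => h.le).frequently
  have hd : G (discontinuityJump f fun n => normalizedState (B n)).toReal < ε / 4 := by
    rw [discontinuityJump, ← hxB 0]
    change G (_ - (y 0 : EReal)).toReal < _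
    generalize limsup (fun n => f (normalizedState (B n))) atTop = L at hup hlow
    lift L to ℝ using ⟨ne_top_of_le_ne_top (EReal.coe_ne_top _) hup,
      ne_bot_of_le_ne_bot (EReal.coe_ne_bot _) hlow⟩
    have h1 : L ≤ y 0 + β := by exact_mod_cast hup
    have h2 : y 0 ≤ L := by exact_mod_cast hlow
    rw [← EReal.coe_sub, EReal.toReal_coe]
    exact hGr _ (by linarith) (by linarith)
  have hJ2 : discontinuityJump f (fun n => normalizedState (A n)) < ((ε / 4 : ℝ) : EReal) :=
    hJ.trans_lt (by exact_mod_cast hd)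
  have hlimA : limsup (fun n => f (normalizedState (A n))) atTop <
      ((x 0 + ε / 4 : ℝ) : EReal) := by
    rw [discontinuityJump, ← hxA 0] at hJ2
    rw [EReal.sub_lt_iff (Or.inl (EReal.coe_ne_bot _)) (Or.inl (EReal.coe_ne_top _))] at hJ2
    refine hJ2.trans_le (le_of_eq ?_)
    rw [add_comm (x 0)]
    norm_cast
  have hxev : ∀ᶠ n in atTop, x n ≤ x 0 + ε / 4 := by
    filter_upwards [eventually_lt_of_limsup_lt hlimA] with n hn
    rw [← hxA n] at hn
    exact_mod_cast hn.le
  filter_upwards [eventually_homExt_le_of_toReal hsp.tendsto_left (fun n => (hfin n).1.1)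
    (hAt 0).2.1 (by positivity : 0 ≤ ε / 4) (by positivity : 0 < ε / 4) hxev] with n hn
  linarith

end Main

/-! ### The theorem -/

theorem theorem6 {H : Type*} [NormedAddCommGroup H] [InnerProductSpace ℂ H] [CompleteSpace H]
    [TopologicalSpace.SeparableSpace H]
    -- the convex set of states, containing all states of finite rank
    (S₀ : Set (H →L[ℂ] H)) (hS₀ : S₀ ⊆ quantumStates H) (hconv : Convex ℝ S₀)
    (hfin : ∀ ω ∈ quantumStates H, (∃ m : ℕ, RankAtMost ω m) → ω ∈ S₀)
    -- the two sequences; their limits are the terms of index `0`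
    (ρ τ : ℕ → H →L[ℂ] H) (hρ : ∀ n, ρ n ∈ S₀) (hτ : ∀ n, τ n ∈ S₀)
    (hρlim : TraceTendsto ρ (ρ 0)) (hτlim : TraceTendsto τ (τ 0))
    (c : ℝ) (hc : 0 < c) (hdom : ∀ n, c • ρ n ≤ τ n)
    -- `S₀` contains the states dominated by multiples of the `τ n`
    (hher : ∀ n, ∀ ω ∈ quantumStates H, (∃ t : ℝ, ω ≤ t • τ n) → ω ∈ S₀)
    -- the function
    (f : (H →L[ℂ] H) → EReal) (hnonneg : ∀ ω ∈ S₀, 0 ≤ f ω)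
    (hlsc : TraceLowerSemicontinuousOn f S₀) (hLAA : LocallyAlmostAffineOn f S₀)
    (hfτ : ∀ n, f (τ n) < ⊤) :
    (∀ n, f (ρ n) < ⊤) ∧
    -- A
    ((∃ C : ℝ, ∀ φ : H, ‖φ‖ = 1 → f (InnerProductSpace.rankOne ℂ φ φ) ≤ C) →
      discontinuityJump f ρ ≤ ((1 / c : ℝ) : EReal) * discontinuityJump f τ ∧
      (ConvergesAlong f τ → ConvergesAlong f ρ)) ∧
    -- B
    (ConvergesAlong f τ →
      (∃ G : ℝ → ℝ, G 0 = 0 ∧ Tendsto G (𝓝[>] 0) (𝓝 0) ∧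
        ∀ ρ' τ' : ℕ → H →L[ℂ] H,
          (∀ n, ρ' n ∈ quantumStates H) → (∀ n, τ' n ∈ quantumStates H) →
          TraceTendsto ρ' (ρ' 0) → TraceTendsto τ' (τ' 0) →
          (∀ n, ρ' n ≤ (2 : ℝ) • ρ n) →
          (∀ n, c • ρ' n ≤ (2 : ℝ) • τ' n) → (∀ n, (2 : ℝ) • τ' n ≤ (4 : ℝ) • τ n) →
          (∃ m : ℕ, ∀ n, RankAtMost (τ' n) m) →
          discontinuityJump f ρ' ≤ (G (discontinuityJump f τ').toReal : EReal)) →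
      ConvergesAlong f ρ) := by
  obtain ⟨w, hw⟩ := hLAA.exists_isAffinityModulus
  have hρq := fun n => hS₀ (hρ n)
  have hτq := fun n => hS₀ (hτ n)
  have hbot : ∀ ω ∈ S₀, f ω ≠ ⊥ := fun ω hω => (EReal.bot_lt_zero.trans_le (hnonneg ω hω)).ne'
  have hfb : ∀ n (X : H →L[ℂ] H) (t : ℝ), 0 ≤ X → X ≤ t • τ n → IsFiniteAt f S₀ X :=
    fun n X t h0 ht => hLAA.isFiniteAt_of_le hS₀ hnonneg (hτ n) (hfτ n).ne (hher n) h0 ht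
  have hfρ : ∀ n, f (ρ n) ≠ ⊤ := by
    intro n
    have h := (hfb n (c • ρ n) 1 (smul_nonneg hc.le (hρq n).1)
      (by rw [one_smul]; exact hdom n)).smul (inv_nonneg.2 hc.le)
    rw [smul_smul, inv_mul_cancel₀ hc.ne', one_smul] at h
    have := h.finite (by rw [(hρq n).2]; exact one_ne_zero)
    rwa [normalizedState_of_mem (hρq n)] at this
  have hx : ∀ n, ((f (ρ n)).toReal : EReal) = f (ρ n) := fun n =>
    EReal.coe_toReal (hfρ n) (hbot _ (hρ n))
  have hy : ∀ n, ((f (τ n)).toReal : EReal) = f (τ n) := fun n =>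
    EReal.coe_toReal (hfτ n).ne (hbot _ (hτ n))
  have hτreal : ConvergesAlong f τ →
      Tendsto (fun n => (f (τ n)).toReal) atTop (𝓝 (f (τ 0)).toReal) := fun h =>
    (EReal.tendsto_toReal (hfτ 0).ne (hbot _ (hτ 0))).comp h.1
  -- Only the upper estimate depends on (A) or (B); the matching lower bound on f(ρₙ) is lower
  -- semicontinuity.
  have hconvergence : ConvergesAlong f τ →
      (∀ ε > 0, ∀ᶠ n in atTop, c * ((f (ρ n)).toReal - (f (ρ 0)).toReal) ≤
        (f (τ n)).toReal - (f (τ 0)).toReal + ε) → ConvergesAlong f ρ := by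
    intro h1 h2
    refine ⟨?_, lt_top_iff_ne_top.2 (hfρ 0)⟩
    have := tendsto_of_eventually_mul_sub_le hc h2 (fun ε hε => ?_) (hτreal h1)
    · have h3 := (continuous_coe_real_ereal.tendsto _).comp this
      rw [hx 0] at h3
      exact h3.congr hx
    · have := hlsc.eventually_homExt hnonneg hρlim
        (fun n => isFiniteAt_of_mem hS₀ (hρ n) (hfρ n))
        (isFiniteAt_of_mem hS₀ (hρ 0) (hfρ 0)) hε
      simpa only [homExt_of_mem f (hρq _)] using this
  have hmain := eventually_mul_sub_le_of_splitting hw hconv hnonneg hlsc hc hρq hτq hρlim hτlim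
    hdom hfb
  refine ⟨fun n => lt_top_iff_ne_top.2 (hfρ n), fun ⟨C, hC⟩ => ?_, fun hτc hG => ?_⟩
  · have h := hmain fun ε hε => by
      filter_upwards [Ioc_mem_nhdsGT (by norm_num : (0 : ℝ) < 1 / 2)] with η hη A B m hsp
      exact hw.eventually_homExt_le hconv hfin hnonneg hC hsp.tendsto_left hsp.nonneg_left
        (hsp.nonneg_left 0) hsp.rank_left (hsp.rank_left 0) (half_le_opTrace_of_lt (hρq 0)
          (hsp.nonneg_left 0) (hsp.le_left 0) hη (hsp.trace_left 0)).2.2.1 hε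
    refine ⟨?_, fun hτc => hconvergence hτc h⟩
    have := limsup_sub_le_mul hc (fun n => EReal.toReal_nonneg (hnonneg _ (hτ n))) h
    simpa only [discontinuityJump, hx, hy] using this
  · obtain ⟨G, hG0, hGt, hjump⟩ := hG
    refine hconvergence hτc (hmain (eventually_homExt_left_le_of_jump hw hconv hnonneg hlsc hc hρq
      hτq hτlim hdom hfb (fun δ hδ => ?_) hG0 hGt hjump))
    filter_upwards [(hτreal hτc).eventually (gt_mem_nhds (lt_add_of_pos_right _ hδ))] with n hn
    rw [homExt_of_mem f (hτq n), homExt_of_mem f (hτq 0)]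
    exact hn.le
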